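/- **Setting.** A *mixing matrix* is a non-negative primitive matrix $W=[w_{ij}]\in\mathbb{R}^{n\times n}$ with $\mathbf 1^\top W=\mathbf 1^\top$. Let $\pi$ be its equilibrium vector, i.e. the positive vector with $W\pi=\pi$ and $\mathbf 1^\top\pi=1$, and put $$\beta_\pi=\big\|\mathrm{diag}(\sqrt{\pi})^{-1}(W-\pi\mathbf 1^\top)\,\mathrm{diag}(\sqrt{\pi})\big\|_2,\qquad \kappa_\pi=\frac{\max_i\pi_i}{\min_i\pi_i}.$$ For local functions $f_1,\dots,f_n:\mathbb{R}^d\to\mathbb{R}$ put $f=\frac1n\sum_i f_i$. The functions belong to $\mathcal F_{\Delta,L}$ with starting point $x^{(0)}$ if every $f_i$ is differentiable with $L$-Lipschitz gradient and $f(x^{(0)})-\inf f\le\Delta$. Stochastic gradient oracles $g_i(x;\xi_i)$, where $\xi_i$ has law $\mathcal D_i$, belong to $\mathcal O_{\sigma^2}$ if $\mathbb E[g_i(x;\xi_i)]=\nabla f_i(x)$ and $\mathbb E\|g_i(x;\xi_i)-\nabla f_i(x)\|^2\le\sigma^2$ for all $x$ and $i$. A *linear-spanning algorithm gossiping through $W$,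 with at most $R$ gossip rounds per iteration*, works as follows. All nodes start at $x_i^{(0)}=x^{(0)}$, and node $i$ has the memory space $M_i^{(0)}=\mathrm{span}\{x^{(0)}\}$. In iteration $k$ node $i$ queries its oracle once, at its local solution $x_i^{(k)}\in M_i^{(k)}$, with a fresh sample $\xi_i^{(k)}$ (all samples are independent), and adds the answer to its memory space. Then there are at most $R$ rounds of gossip, in each of which node $i$ adds to its space the vectors $\sum_j w_{ij}z_j$, where each $z_j$ is in the current space of node $j$. The result is $M_i^{(k+1)}$. After $K$ iterations the output $\hat x^{(K)}$ is any vector of $\mathrm{span}\{x_i^{(k)}:1\le i\le n,\ 0\le k\le K\}$. The choices may be random and adaptive. **Theorem.** For every $\beta_0>0$ and every $R\in\mathbb N$ there is a constant $c>0$, depending only on $\beta_0$ and $R$, such that the following holds. For every $n\ge2$ and every $\tilde\beta\in[\beta_0,1-1/n]$ there is a mixing matrix $W\in\mathbb{R}^{n\times n}$ with $\beta_\pi=\tilde\beta$ and $\ln\kappa_\pi\ge c\,n(1-\beta_\pi)$ such that for all $L,\Delta,\sigma\ge0$ and all $K\ge n$ there are a dimension $d\ge1$, a starting point $x^{(0)}\in\mathbb{R}^d$,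 functions $\{f_i\}_{i=1}^n\in\mathcal F_{\Delta,L}$ and oracles in $\mathcal O_{\sigma^2}$ for which every linear-spanning algorithm gossiping through $W$ with at most $R$ gossip rounds per iteration satisfies, after $K$ iterations, $$\mathbb E\big[\|\nabla f(\hat x^{(K)})\|_2^2\big]\ \ge\ c\left(\min\Big\{\frac{\sigma\sqrt{L\Delta}}{\sqrt{nK}},\,L\Delta\Big\}+\frac{(1+\ln\kappa_\pi)L\Delta}{(1-\beta_\pi)K}\right).$$ In particular, the right-hand side is $c\Big(\frac{\sigma\sqrt{L\Delta}}{\sqrt{nK}}+\frac{(1+\ln\kappa_\pi)L\Delta}{(1-\beta_\pi)K}\Big)$ as soon as $\sigma^2\le nKL\Delta$. -/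

import Mathlib

open MeasureTheory ProbabilityTheory

/-- A mixing matrix: non-negative and primitive (`Matrix.IsPrimitive`), with unit column sums. -/
structure IsMixingMatrix {n : ℕ} (W : Matrix (Fin n) (Fin n) ℝ) : Prop where
  primitive : W.IsPrimitive
  colSum : ∀ j, ∑ i, W i j = 1

/-- The equilibrium vector of `W`: the normalized right eigenvector for the eigenvalue `1`,
with positive entries. -/
structure IsEquilibriumVector {n : ℕ} (W : Matrix (Fin n) (Fin n) ℝ) (π : Fin n → ℝ) : Prop where
  pos : ∀ i, 0 < π i
  fixed : W.mulVec π = π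
  sum_eq_one : ∑ i, π i = 1

/-- The weighted matrix norm `‖A‖_π = ‖diag(√π)⁻¹ A diag(√π)‖₂` (spectral norm on the right). -/
noncomputable def piNorm {n : ℕ} (π : Fin n → ℝ) (A : Matrix (Fin n) (Fin n) ℝ) : ℝ :=
  ‖Matrix.toEuclideanCLM (𝕜 := ℝ)
    (Matrix.diagonal (fun i => (Real.sqrt (π i))⁻¹) * A *
      Matrix.diagonal (fun i => Real.sqrt (π i)))‖

/-- `β_π = ‖W - π 𝟙ᵀ‖_π`; the generalized spectral gap is `1 - β_π`. -/
noncomputable def betaPi {n : ℕ} (W : Matrix (Fin n) (Fin n) ℝ) (π : Fin n → ℝ) : ℝ :=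
  piNorm π (W - Matrix.vecMulVec π 1)

/-- The equilibrium skewness `κ_π = max π / min π`. -/
noncomputable def kappaPi {n : ℕ} (π : Fin n → ℝ) : ℝ :=
  (⨆ i, π i) / (⨅ i, π i)

/-- The global objective `f = n⁻¹ ∑ i, f i`. -/
noncomputable def avgFun {n d : ℕ} (f : Fin n → EuclideanSpace ℝ (Fin d) → ℝ) :
    EuclideanSpace ℝ (Fin d) → ℝ :=
  fun x => (n : ℝ)⁻¹ * ∑ i, f i x

/-- The function class: all local functions are differentiable with `L`-Lipschitz gradient, and
`f(x₀) - inf f ≤ Δ` for the average `f` (in particular, `f` is bounded below). -/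
structure InFunctionClass {n d : ℕ} (L Δ : ℝ) (x₀ : EuclideanSpace ℝ (Fin d))
    (f : Fin n → EuclideanSpace ℝ (Fin d) → ℝ) : Prop where
  differentiable : ∀ i, Differentiable ℝ (f i)
  smooth : ∀ i x y, ‖gradient (f i) x - gradient (f i) y‖ ≤ L * ‖x - y‖
  gap : ∀ x, avgFun f x₀ - avgFun f x ≤ Δ

/-- Stochastic first-order oracles of `n` nodes: node `i` draws a sample from the distribution
`law i` on `Ξ`, and `grad i x s` is its answer at the point `x` when the sample is `s`. -/
structure StochasticOracles (n d : ℕ) where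
  Ξ : Type
  [measurableSpace : MeasurableSpace Ξ]
  law : Fin n → Measure Ξ
  [isProbabilityMeasure : ∀ i, IsProbabilityMeasure (law i)]
  grad : Fin n → EuclideanSpace ℝ (Fin d) → Ξ → EuclideanSpace ℝ (Fin d)
  measurable_grad : ∀ i, Measurable (Function.uncurry (grad i))

attribute [instance] StochasticOracles.measurableSpace StochasticOracles.isProbabilityMeasure

/-- The oracle class: unbiased estimates of the local gradients with variance at most `σ²`. -/
structure InOracleClass {n d : ℕ} (σ : ℝ) (f : Fin n → EuclideanSpace ℝ (Fin d) → ℝ)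
    (O : StochasticOracles n d) : Prop where
  integrable : ∀ i x, Integrable (O.grad i x) (O.law i)
  unbiased : ∀ i x, ∫ s, O.grad i x s ∂(O.law i) = gradient (f i) x
  integrable_sq : ∀ i x, Integrable (fun s => ‖O.grad i x s - gradient (f i) x‖ ^ 2) (O.law i)
  variance : ∀ i x, ∫ s, ‖O.grad i x s - gradient (f i) x‖ ^ 2 ∂(O.law i) ≤ σ ^ 2

/-- One round of gossip through `W`. If `M j` is the space of the vectors that node `j` can form,
then node `i` afterwards can form the vectors in its own space and the combinations
`∑ j, W i j • z j` with `z j ∈ M j`; their span is the sum of `M i` and of the `M j` with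
`W i j ≠ 0`. -/
def gossip {n d : ℕ} (W : Matrix (Fin n) (Fin n) ℝ)
    (M : Fin n → Submodule ℝ (EuclideanSpace ℝ (Fin d))) :
    Fin n → Submodule ℝ (EuclideanSpace ℝ (Fin d)) :=
  fun i => M i ⊔ ⨆ (j : Fin n) (_ : W i j ≠ 0), M j

/-- `memory W R x₀ g k i` is the space of the vectors available to node `i` after `k` iterations.
At first it is spanned by `x₀`. In iteration `k` each node adds the stochastic gradient `g k i`
that its oracle returns, and then at most `R` rounds of gossip take place. -/
def memory {n d : ℕ} (W : Matrix (Fin n) (Fin n) ℝ) (R : ℕ) (x₀ : EuclideanSpace ℝ (Fin d))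
    (g : ℕ → Fin n → EuclideanSpace ℝ (Fin d)) :
    ℕ → Fin n → Submodule ℝ (EuclideanSpace ℝ (Fin d))
  | 0 => fun _ => Submodule.span ℝ {x₀}
  | k + 1 => (gossip W)^[R] (fun i => memory W R x₀ g k i ⊔ Submodule.span ℝ {g k i})

/-- `x k i` (iterates) and `xhat` (output) are produced in `K` iterations by a linear-spanning
algorithm that gossips through `W`, at most `R` rounds per iteration, with all nodes started at
`x₀`. The samples `ξ k i` are independent, and node `i` queries its oracle once per iteration, at
its local solution `x k i`. The coefficients of the linear combinations may depend on the sample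
point in any (measurable) way, so randomized and adaptive algorithms are included. -/
structure IsLinearSpanningRun {n d : ℕ} (W : Matrix (Fin n) (Fin n) ℝ) (R K : ℕ)
    (x₀ : EuclideanSpace ℝ (Fin d)) (O : StochasticOracles n d)
    {Ω : Type*} [MeasurableSpace Ω] (μ : Measure Ω)
    (ξ : ℕ → Fin n → Ω → O.Ξ) (x : ℕ → Fin n → Ω → EuclideanSpace ℝ (Fin d))
    (xhat : Ω → EuclideanSpace ℝ (Fin d)) : Prop where
  measurable_sample : ∀ k i, Measurable (ξ k i)
  map_sample : ∀ k i, μ.map (ξ k i) = O.law i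
  indep_sample : iIndepFun (fun (p : ℕ × Fin n) => ξ p.1 p.2) μ
  measurable_iterate : ∀ k i, Measurable (x k i)
  measurable_output : Measurable xhat
  initial : ∀ i ω, x 0 i ω = x₀
  iterate_mem : ∀ k i ω, k ≤ K →
    x k i ω ∈ memory W R x₀ (fun l j => O.grad j (x l j ω) (ξ l j ω)) k i
  output_mem : ∀ ω, xhat ω ∈ Submodule.span ℝ {z | ∃ k ≤ K, ∃ i, z = x k i ω}

/-! The matrix is that of a reset chain: mass at an index either moves one step up or falls back to
0. Its equilibrium is truncated geometric with some ratio r, so ln κ_π = (n - 1) ln(1/r), where r =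
β² (r = β if n = 2). Hence ln κ_π is of order n(1 - β), with constants depending on β₀, and (1 + ln
κ_π)/(1 - β) is at most a constant times n. It remains to prove two bounds, of order LΔn/K and of
order min(σ√(LΔ)/√(nK), LΔ). They may use different instances, since a sum is at most twice its
larger term.

Both instances rest on a chain function of T coordinates. At a point supported on the first m
coordinates its gradient reveals at most one more, and its squared norm stays of order LΔ/T at least
until the last coordinate is found (`le_norm_gradient_scaledChain_sq`). So T is chosen just above
the number of coordinates that can be discovered.

Network term (`admitsHardInstance_split`): information climbs at most one index per gossip round.
The even terms of the chain go to the lowest third of the nodes and the odd ones to the highest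
third, so two new coordinates cost a climb of order n, and T of order 1 + RK/n suffices.

Statistical term (`admitsHardInstance_coin`): all nodes hold the same chain, and the oracle shows
the next coordinate only with probability p, scaled by 1/p. By Markov's inequality the nK queries
yield fewer than T successes with probability at least 1/2 when nKp ≤ T/2. The variance bound allows
T of order √(LΔnK)/σ. -/

/-! ### The weighted norm as a contraction factor -/

/-- The weighted norm of a matrix `W` minus its equilibrium projection equals `b` if `b` is the
attained contraction factor of `W` on the vectors of sum zero, with weights `1 / π`. -/
theorem betaPi_eq_of_contraction {n : ℕ} {W : Matrix (Fin n) (Fin n) ℝ} {π : Fin n → ℝ}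
    (hπ : IsEquilibriumVector W π) {b : ℝ} (hb : 0 ≤ b)
    (hle : ∀ v : Fin n → ℝ, ∑ i, v i = 0 →
      ∑ i, (W.mulVec v i) ^ 2 / π i ≤ b ^ 2 * ∑ i, v i ^ 2 / π i)
    (v₀ : Fin n → ℝ) (hv₀ : v₀ ≠ 0) (hsum : ∑ i, v₀ i = 0)
    (heq : ∑ i, (W.mulVec v₀ i) ^ 2 / π i = b ^ 2 * ∑ i, v₀ i ^ 2 / π i) :
    betaPi W π = b := by
  have hs : ∀ i, 0 < Real.sqrt (π i) := fun i => Real.sqrt_pos.2 (hπ.pos i)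
  -- As `W` fixes π, subtracting π𝟙ᵀ amounts to projecting the argument to sum zero before applying
  -- `W`.
  have key : ∀ u : EuclideanSpace ℝ (Fin n), ∀ i,
      (Matrix.toEuclideanCLM (𝕜 := ℝ)
        (Matrix.diagonal (fun i => (Real.sqrt (π i))⁻¹) * (W - Matrix.vecMulVec π 1) *
          Matrix.diagonal (fun i => Real.sqrt (π i))) u) i =
      (Real.sqrt (π i))⁻¹ * W.mulVec (fun j => Real.sqrt (π j) * u j -
        (∑ k, Real.sqrt (π k) * u k) * π j) i := by
    intro u i
    have h1 : (fun j => Real.sqrt (π j) * u j - (∑ k, Real.sqrt (π k) * u k) * π j) =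
        (fun j => Real.sqrt (π j) * u j) - (∑ k, Real.sqrt (π k) * u k) • π := by
      ext j; simp
    rw [h1, Matrix.mulVec_sub, Matrix.mulVec_smul, hπ.fixed]
    have h2 : (Matrix.diagonal (fun i => Real.sqrt (π i))).mulVec u.ofLp =
        fun j => Real.sqrt (π j) * u j := by
      ext j; simp [Matrix.mulVec_diagonal]
    rw [Matrix.ofLp_toEuclideanCLM, ← Matrix.mulVec_mulVec, ← Matrix.mulVec_mulVec, h2,
      Matrix.mulVec_diagonal, Matrix.sub_mulVec, Matrix.vecMulVec_mulVec]
    simp [dotProduct, mul_comm]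
  have hnorm : ∀ u : EuclideanSpace ℝ (Fin n), ‖Matrix.toEuclideanCLM (𝕜 := ℝ)
        (Matrix.diagonal (fun i => (Real.sqrt (π i))⁻¹) * (W - Matrix.vecMulVec π 1) *
          Matrix.diagonal (fun i => Real.sqrt (π i))) u‖ ^ 2 =
      ∑ i, (W.mulVec (fun j => Real.sqrt (π j) * u j -
        (∑ k, Real.sqrt (π k) * u k) * π j) i) ^ 2 / π i := by
    intro u
    rw [EuclideanSpace.norm_sq_eq]
    refine Finset.sum_congr rfl fun i _ => ?_
    rw [key, Real.norm_eq_abs, sq_abs, mul_pow, inv_pow, Real.sq_sqrt (hπ.pos i).le]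
    ring
  apply le_antisymm
  · refine ContinuousLinearMap.opNorm_le_bound _ hb fun u => ?_
    refine le_of_sq_le_sq ?_ (by positivity)
    rw [hnorm]
    set c := ∑ k, Real.sqrt (π k) * u k with hc
    refine (hle _ ?_).trans ?_
    · rw [Finset.sum_sub_distrib, ← Finset.mul_sum, hπ.sum_eq_one]; simp [hc]
    · rw [mul_pow]
      refine mul_le_mul_of_nonneg_left ?_ (sq_nonneg b)
      -- Removing the component along the unit vector √π is an orthogonal projection: the sum
      -- becomes ‖u‖² - c².
      have h3 : ∀ i, (Real.sqrt (π i) * u i - c * π i) ^ 2 / π i =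
          u i ^ 2 - 2 * c * (Real.sqrt (π i) * u i) + c ^ 2 * π i := by
        intro i
        have h4 := Real.sq_sqrt (hπ.pos i).le
        have h5 := (hs i).ne'
        rw [div_eq_iff (hπ.pos i).ne']
        calc _ = Real.sqrt (π i) ^ 2 * u i ^ 2 - 2 * c * (Real.sqrt (π i) * u i) * π i
              + c ^ 2 * π i * π i := by ring
          _ = _ := by rw [h4]; ring
      simp_rw [h3]
      rw [Finset.sum_add_distrib, Finset.sum_sub_distrib, ← Finset.mul_sum, ← Finset.mul_sum,
        hπ.sum_eq_one, ← hc, EuclideanSpace.norm_sq_eq]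
      simp only [Real.norm_eq_abs, sq_abs]
      nlinarith [sq_nonneg c]
  · set u : EuclideanSpace ℝ (Fin n) := WithLp.toLp 2 (fun i => v₀ i / Real.sqrt (π i)) with hu
    have hu1 : ∀ i, Real.sqrt (π i) * u i = v₀ i := by
      intro i; have := (hs i).ne'; simp only [hu]; field_simp
    have h6 := hnorm u
    simp only [hu1, hsum, zero_mul, sub_zero] at h6
    have h7 : ‖u‖ ^ 2 = ∑ i, v₀ i ^ 2 / π i := by
      rw [EuclideanSpace.norm_sq_eq]
      refine Finset.sum_congr rfl fun i _ => ?_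
      rw [Real.norm_eq_abs, sq_abs, ← hu1 i, mul_pow, Real.sq_sqrt (hπ.pos i).le]
      have := (hπ.pos i).ne'
      field_simp
    have h8 : 0 < ‖u‖ := by
      rw [norm_pos_iff]
      rintro h
      apply hv₀
      ext i
      rw [← hu1 i, h]; simp
    have h9 := ContinuousLinearMap.le_opNorm (Matrix.toEuclideanCLM (𝕜 := ℝ)
        (Matrix.diagonal (fun i => (Real.sqrt (π i))⁻¹) * (W - Matrix.vecMulVec π 1) *
          Matrix.diagonal (fun i => Real.sqrt (π i)))) u
    change b ≤ ‖_‖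
    refine le_of_mul_le_mul_right (le_trans ?_ h9) h8
    refine le_of_eq ?_
    rw [← sq_eq_sq₀ (by positivity) (norm_nonneg _), h6, heq, mul_pow, h7]

/-! ### The reset chain -/

/-- The chain on `0, …, N` that moves one step up with probability `r` and otherwise, or at the
top, is reset to `0`. -/
def resetMatrix (N : ℕ) (r : ℝ) : Matrix (Fin (N + 1)) (Fin (N + 1)) ℝ :=
  fun i j => Fin.cases (if j = Fin.last N then 1 else 1 - r)
    (fun k => if j = k.castSucc then r else 0) i

/-- The truncated geometric distribution on `0, …, N`. -/
noncomputable def geomVector (N : ℕ) (r : ℝ) : Fin (N + 1) → ℝ :=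
  fun i => r ^ (i : ℕ) / ∑ j : Fin (N + 1), r ^ (j : ℕ)

@[simp] theorem resetMatrix_zero_last (N : ℕ) (r : ℝ) :
    resetMatrix N r 0 (Fin.last N) = 1 := by
  simp [resetMatrix]

@[simp] theorem resetMatrix_zero_castSucc {N : ℕ} (r : ℝ) (j : Fin N) :
    resetMatrix N r 0 j.castSucc = 1 - r := by
  simp [resetMatrix, (Fin.castSucc_lt_last j).ne]

@[simp] theorem resetMatrix_succ {N : ℕ} (r : ℝ) (k : Fin N) (j : Fin (N + 1)) :
    resetMatrix N r k.succ j = if j = k.castSucc then r else 0 := by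
  simp [resetMatrix]

theorem resetMatrix_mulVec_succ {N : ℕ} (r : ℝ) (v : Fin (N + 1) → ℝ) (k : Fin N) :
    (resetMatrix N r).mulVec v k.succ = r * v k.castSucc := by
  simp [Matrix.mulVec, dotProduct]

theorem resetMatrix_mulVec_zero {N : ℕ} (r : ℝ) (v : Fin (N + 1) → ℝ) :
    (resetMatrix N r).mulVec v 0 = (1 - r) * ∑ j, v j + r * v (Fin.last N) := by
  simp only [Matrix.mulVec, dotProduct, Fin.sum_univ_castSucc, resetMatrix_zero_castSucc,
    resetMatrix_zero_last, ← Finset.mul_sum]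
  ring

theorem resetMatrix_ne_zero_le {N : ℕ} {r : ℝ} {i j : Fin (N + 1)}
    (h : resetMatrix N r i j ≠ 0) : (i : ℕ) ≤ j + 1 := by
  induction i using Fin.cases with
  | zero => simp
  | succ k =>
    rw [resetMatrix_succ] at h
    split_ifs at h with hj
    · simp [hj]
    · exact absurd rfl h

theorem resetMatrix_nonneg {N : ℕ} {r : ℝ} (hr : 0 < r) (hr1 : r < 1) (i j : Fin (N + 1)) :
    0 ≤ resetMatrix N r i j := by
  induction i using Fin.cases with
  | zero =>
    induction j using Fin.lastCases with
    | last => simp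
    | cast k => simp [hr1.le]
  | succ k => rw [resetMatrix_succ]; split_ifs <;> simp [hr.le]

theorem resetMatrix_zero_pos {N : ℕ} {r : ℝ} (hr1 : r < 1) (j : Fin (N + 1)) :
    0 < resetMatrix N r 0 j := by
  induction j using Fin.lastCases with
  | last => simp
  | cast k => simp [hr1]

/-- From any state one can reset to 0 and then reach any index in exactly N steps by waiting at 0
before climbing; so the power N + 1 is positive. -/
theorem resetMatrix_isMixingMatrix {N : ℕ} {r : ℝ} (hr : 0 < r) (hr1 : r < 1) :
    IsMixingMatrix (resetMatrix N r) := by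
  have hnn := resetMatrix_nonneg (N := N) hr hr1
  have hpow : ∀ k, ∀ i j, 0 ≤ (resetMatrix N r ^ k) i j := by
    intro k
    induction k with
    | zero => intro i j; rw [pow_zero, Matrix.one_apply]; split_ifs <;> simp
    | succ k ih =>
      intro i j
      rw [pow_succ, Matrix.mul_apply]
      exact Finset.sum_nonneg fun l _ => mul_nonneg (ih _ _) (hnn _ _)
  have hcol : ∀ k : ℕ, ∀ i : Fin (N + 1), (i : ℕ) ≤ k → 0 < (resetMatrix N r ^ k) i 0 := by
    intro k
    induction k with
    | zero =>
      intro i hi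
      have : i = 0 := Fin.ext (by simpa using hi)
      simp [this]
    | succ k ih =>
      intro i hi
      rw [pow_succ', Matrix.mul_apply]
      refine Finset.sum_pos' (fun l _ => mul_nonneg (hnn _ _) (hpow _ _ _)) ?_
      induction i using Fin.cases with
      | zero => exact ⟨0, Finset.mem_univ _, mul_pos (resetMatrix_zero_pos hr1 _) (ih _ (by simp))⟩
      | succ l =>
        refine ⟨l.castSucc, Finset.mem_univ _, mul_pos (by simp [hr]) (ih _ ?_)⟩
        simpa using hi
  refine ⟨⟨hnn, N + 1, N.succ_pos, fun i j => ?_⟩, fun j => ?_⟩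
  · rw [pow_succ, Matrix.mul_apply]
    exact Finset.sum_pos' (fun l _ => mul_nonneg (hpow _ _ _) (hnn _ _))
      ⟨0, Finset.mem_univ _, mul_pos (hcol N i (by omega)) (resetMatrix_zero_pos hr1 _)⟩
  · rw [Fin.sum_univ_succ]
    induction j using Fin.lastCases with
    | last => simp [fun k : Fin N => (Fin.castSucc_lt_last k).ne']
    | cast k => simp

theorem geomVector_pos {N : ℕ} {r : ℝ} (hr : 0 < r) (i : Fin (N + 1)) :
    0 < geomVector N r i := by
  unfold geomVector
  exact div_pos (by positivity) (Finset.sum_pos (fun _ _ => by positivity) Finset.univ_nonempty)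

theorem geomVector_succ {N : ℕ} (r : ℝ) (k : Fin N) :
    geomVector N r k.succ = r * geomVector N r k.castSucc := by
  simp [geomVector, pow_succ]; ring

theorem geomVector_eq {N : ℕ} (r : ℝ) (i : Fin (N + 1)) :
    geomVector N r i = r ^ (i : ℕ) * geomVector N r 0 := by
  simp [geomVector]; ring

theorem geomVector_sum {N : ℕ} {r : ℝ} (hr : 0 < r) : ∑ i, geomVector N r i = 1 := by
  unfold geomVector
  rw [← Finset.sum_div, div_self]
  exact (Finset.sum_pos (fun _ _ => by positivity) Finset.univ_nonempty).ne'

theorem geomVector_isEquilibriumVector {N : ℕ} {r : ℝ} (hr : 0 < r) :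
    IsEquilibriumVector (resetMatrix N r) (geomVector N r) := by
  refine ⟨geomVector_pos hr, ?_, geomVector_sum hr⟩
  ext i
  induction i using Fin.cases with
  | zero =>
    have h1 : ∑ j, geomVector N r j = geomVector N r 0 + r * ∑ j, geomVector N r j
        - r * geomVector N r (Fin.last N) := by
      conv_lhs => rw [Fin.sum_univ_succ]
      conv_rhs => rw [Fin.sum_univ_castSucc]
      simp only [geomVector_succ, ← Finset.mul_sum]
      ring
    rw [resetMatrix_mulVec_zero]
    linarith
  | succ k => rw [resetMatrix_mulVec_succ, geomVector_succ]

theorem log_kappaPi_geomVector {N : ℕ} {r : ℝ} (hr : 0 < r) (hr1 : r < 1) :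
    Real.log (kappaPi (geomVector N r)) = N * Real.log r⁻¹ := by
  have h0 := geomVector_pos (N := N) hr 0
  have hsup : ⨆ i, geomVector N r i = geomVector N r 0 := by
    refine le_antisymm (ciSup_le fun i => ?_) (le_ciSup (Set.finite_range _).bddAbove 0)
    rw [geomVector_eq r i]
    exact mul_le_of_le_one_left h0.le (pow_le_one₀ hr.le hr1.le)
  have hinf : ⨅ i, geomVector N r i = r ^ N * geomVector N r 0 := by
    refine le_antisymm ?_ (le_ciInf fun i => ?_)
    · refine (ciInf_le (Set.finite_range _).bddBelow (Fin.last N)).trans ?_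
      rw [geomVector_eq]; simp
    · rw [geomVector_eq r i]
      exact mul_le_mul_of_nonneg_right
        (pow_le_pow_of_le_one hr.le hr1.le (Nat.lt_succ_iff.1 i.2)) h0.le
  rw [kappaPi, hsup, hinf, ← Real.log_pow]
  congr 1
  rw [inv_pow, div_eq_iff (by positivity), inv_mul_cancel_left₀ (by positivity)]

/-- The squared weighted norm of `W v` for a vector `v` of sum zero. -/
theorem resetMatrix_sum_sq {N : ℕ} {r : ℝ} (hr : 0 < r) (v : Fin (N + 1) → ℝ)
    (hv : ∑ i, v i = 0) :
    ∑ i, ((resetMatrix N r).mulVec v i) ^ 2 / geomVector N r i =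
      r ^ 2 * v (Fin.last N) ^ 2 / geomVector N r 0 +
        r * ∑ j : Fin N, v j.castSucc ^ 2 / geomVector N r j.castSucc := by
  rw [Fin.sum_univ_succ, resetMatrix_mulVec_zero, hv, Finset.mul_sum]
  congr 1
  · ring
  · refine Finset.sum_congr rfl fun k _ => ?_
    rw [resetMatrix_mulVec_succ, geomVector_succ]
    have := (geomVector_pos hr k.castSucc).ne'
    field_simp

/-- On vectors of sum zero the constant part of the reset row vanishes. A step up multiplies an
entry by r and its weight 1/π by 1/r, so squared norms shrink by r; the top entry shrinks more.
Equality needs a vector that vanishes at the top, and for `2 ≤ N` there is (1, -1, 0, …). -/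
theorem betaPi_resetMatrix {N : ℕ} {r : ℝ} (hr : 0 < r) (hr1 : r < 1) (hN : 2 ≤ N) :
    betaPi (resetMatrix N r) (geomVector N r) = Real.sqrt r := by
  obtain ⟨M, rfl⟩ : ∃ M, N = M + 2 := ⟨N - 2, by omega⟩
  have h0 := geomVector_pos (N := M + 2) hr 0
  have hsum : ∑ i, (Fin.cons 1 (Fin.cons (-1) 0) : Fin (M + 2 + 1) → ℝ) i = 0 := by
    rw [Fin.sum_cons, Fin.sum_cons]; simp
  have hlast : (Fin.cons 1 (Fin.cons (-1) 0) : Fin (M + 2 + 1) → ℝ) (Fin.last (M + 2)) = 0 := by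
    rw [← Fin.succ_last, ← Fin.succ_last, Fin.cons_succ, Fin.cons_succ]; rfl
  refine betaPi_eq_of_contraction (geomVector_isEquilibriumVector hr) (Real.sqrt_nonneg r)
    (fun v hv => ?_) (Fin.cons 1 (Fin.cons (-1) 0)) ?_ hsum ?_
  · rw [resetMatrix_sum_sq hr v hv, Real.sq_sqrt hr.le, Fin.sum_univ_castSucc (n := M + 2), mul_add,
      add_comm]
    gcongr
    have h1 : geomVector (M + 2) r (Fin.last (M + 2)) = r ^ (M + 2) * geomVector (M + 2) r 0 := by
      rw [geomVector_eq]; simp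
    have h2 : r ^ (M + 2) ≤ 1 := pow_le_one₀ hr.le hr1.le
    rw [h1, mul_div_assoc, sq r, mul_assoc]
    refine mul_le_mul_of_nonneg_left ?_ hr.le
    calc _ ≤ v (Fin.last (M + 2)) ^ 2 / geomVector (M + 2) r 0 :=
          mul_le_of_le_one_left (by positivity) hr1.le
      _ ≤ _ := by
          refine div_le_div_of_nonneg_left (by positivity) (by positivity) ?_
          exact mul_le_of_le_one_left h0.le h2
  · intro h
    simpa using congrFun h 0
  · rw [resetMatrix_sum_sq hr _ hsum, Real.sq_sqrt hr.le, hlast]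
    conv_rhs => rw [Fin.sum_univ_castSucc, hlast]
    simp

/-- With two states all vectors of sum zero are multiples of (1, -1), which does not vanish at the
top; so the factor is r instead of √r. -/
theorem betaPi_resetMatrix_one {r : ℝ} (hr : 0 < r) :
    betaPi (resetMatrix 1 r) (geomVector 1 r) = r := by
  have h0 := geomVector_pos (N := 1) hr 0
  have key : ∀ v : Fin 2 → ℝ, ∑ i, v i = 0 →
      ∑ i, ((resetMatrix 1 r).mulVec v i) ^ 2 / geomVector 1 r i =
        r ^ 2 * ∑ i, v i ^ 2 / geomVector 1 r i := by
    intro v hv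
    have h1 : geomVector 1 r 1 = r * geomVector 1 r 0 := geomVector_succ r (0 : Fin 1)
    rw [resetMatrix_sum_sq hr v hv]
    rw [Fin.sum_univ_two] at hv
    have h2 : v 1 = - v 0 := by linarith
    simp only [Fin.sum_univ_two, Finset.univ_unique, Finset.sum_singleton, Fin.default_eq_zero]
    change r ^ 2 * v 1 ^ 2 / _ + r * (v 0 ^ 2 / geomVector 1 r 0) = _
    rw [h1, h2]
    field_simp
  refine betaPi_eq_of_contraction (geomVector_isEquilibriumVector hr) hr.le
    (fun v hv => (key v hv).le) ![1, -1] ?_ (by simp) (key _ (by simp))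
  intro h
  simpa using congrFun h 0

/-! ### Bump and step on the line -/

/-- The piecewise linear bump supported on `[0, 2]` with peak value `1` at `1`. -/
noncomputable def tent (x : ℝ) : ℝ := max x 0 - 2 * max (x - 1) 0 + max (x - 2) 0

/-- The antiderivative of `tent`, a step from `0` to `1` with Lipschitz derivative. -/
noncomputable def tentStep (x : ℝ) : ℝ :=
  (max x 0 ^ 2 - 2 * max (x - 1) 0 ^ 2 + max (x - 2) 0 ^ 2) / 2

theorem tent_eq (x : ℝ) : tent x = max (min x (2 - x)) 0 := by
  simp only [tent, max_def, min_def]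
  split_ifs <;> linarith

theorem tent_nonneg (x : ℝ) : 0 ≤ tent x := by rw [tent_eq]; exact le_max_right _ _

theorem tent_le_one (x : ℝ) : tent x ≤ 1 := by
  rw [tent_eq]
  simp only [max_def, min_def]
  split_ifs <;> linarith

theorem abs_tent_le_one (x : ℝ) : |tent x| ≤ 1 := by
  rw [abs_of_nonneg (tent_nonneg x)]; exact tent_le_one x

theorem abs_tent_sub_le (x y : ℝ) : |tent x - tent y| ≤ |x - y| := by
  rw [tent_eq, tent_eq]
  refine (abs_max_sub_max_le_max _ _ _ _).trans ?_
  refine max_le ((abs_min_sub_min_le_max _ _ _ _).trans (max_le le_rfl ?_)) (by simp)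
  rw [abs_sub_comm x y]
  apply le_of_eq
  congr 1
  ring

@[simp] theorem tent_zero : tent 0 = 0 := by simp [tent_eq]

@[simp] theorem tentStep_zero : tentStep 0 = 0 := by norm_num [tentStep]

theorem tent_one : tent 1 = 1 := by norm_num [tent_eq]

theorem hasDerivAt_max_zero_sq (x : ℝ) :
    HasDerivAt (fun x : ℝ => max x 0 ^ 2) (2 * max x 0) x := by
  rcases lt_trichotomy x 0 with h | rfl | h
  · rw [max_eq_right h.le, mul_zero]
    refine (hasDerivAt_const x (0 : ℝ)).congr_of_eventuallyEq ?_
    filter_upwards [gt_mem_nhds h] with y hy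
    simp [max_eq_right hy.le]
  -- At the kink the function is dominated by y², which has derivative 0 there.
  · have h0 : HasDerivAt (fun x : ℝ => x ^ 2) 0 0 := by simpa using hasDerivAt_pow 2 (0 : ℝ)
    rw [hasDerivAt_iff_isLittleO] at h0 ⊢
    refine Asymptotics.IsBigO.trans_isLittleO (Asymptotics.IsBigO.of_bound 1 ?_) h0
    filter_upwards with y
    rcases le_total y 0 with hy | hy <;> simp [hy, sq_nonneg]
  · rw [max_eq_left h.le]
    have h1 : HasDerivAt (fun x : ℝ => x ^ 2) (2 * x) x := by simpa using hasDerivAt_pow 2 x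
    refine h1.congr_of_eventuallyEq ?_
    filter_upwards [lt_mem_nhds h] with y hy
    simp [max_eq_left hy.le]

theorem hasDerivAt_tentStep (x : ℝ) : HasDerivAt tentStep (tent x) x := by
  have h0 := hasDerivAt_max_zero_sq x
  have h1 := (hasDerivAt_max_zero_sq (x - 1)).comp x ((hasDerivAt_id x).sub_const 1)
  have h2 := (hasDerivAt_max_zero_sq (x - 2)).comp x ((hasDerivAt_id x).sub_const 2)
  refine (((h0.sub (h1.const_mul 2)).add h2).div_const 2).congr_deriv ?_
  simp only [tent]
  ring

theorem tentStep_monotone : Monotone tentStep :=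
  monotone_of_hasDerivAt_nonneg hasDerivAt_tentStep tent_nonneg

theorem tentStep_nonneg (x : ℝ) : 0 ≤ tentStep x := by
  refine le_trans (le_of_eq ?_) (tentStep_monotone (min_le_left x 0))
  have h := min_le_right x 0
  simp only [tentStep]
  rw [max_eq_right h, max_eq_right (show min x 0 - 1 ≤ 0 by linarith),
    max_eq_right (show min x 0 - 2 ≤ 0 by linarith)]
  norm_num

theorem tentStep_le_one (x : ℝ) : tentStep x ≤ 1 := by
  refine le_trans (tentStep_monotone (le_max_left x 2)) (le_of_eq ?_)
  have h := le_max_right x 2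
  simp only [tentStep]
  rw [max_eq_left (show 0 ≤ max x 2 by linarith), max_eq_left (show 0 ≤ max x 2 - 1 by linarith),
    max_eq_left (show 0 ≤ max x 2 - 2 by linarith)]
  ring

theorem abs_tentStep_le_one (x : ℝ) : |tentStep x| ≤ 1 := by
  rw [abs_of_nonneg (tentStep_nonneg x)]; exact tentStep_le_one x

theorem abs_tentStep_sub_le (x y : ℝ) : |tentStep x - tentStep y| ≤ |x - y| := by
  have h := Convex.norm_image_sub_le_of_norm_hasDerivWithin_le (f := tentStep) (f' := tent)
    (s := Set.univ) (C := 1) (fun z _ => (hasDerivAt_tentStep z).hasDerivWithinAt)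
    (fun z _ => abs_tent_le_one z) convex_univ (Set.mem_univ y) (Set.mem_univ x)
  simpa using h

theorem hasDerivAt_min_zero_sq (x : ℝ) :
    HasDerivAt (fun x : ℝ => min x 0 ^ 2 / 2) (min x 0) x := by
  have h := ((hasDerivAt_max_zero_sq (-x)).comp x (hasDerivAt_neg x)).div_const 2
  have h1 : ∀ y : ℝ, max (-y) 0 = - min y 0 := by
    intro y; rw [← max_neg_neg, neg_zero]
  simp only [Function.comp_def, h1, neg_sq] at h
  exact h.congr_deriv (by ring)

/-! ### The chain function: gradient, smoothness, slow discovery -/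

section Chain

variable {T : ℕ}

/-- The coordinate `k` of a vector, or `0` beyond the dimension. -/
def coord (k : ℕ) (x : EuclideanSpace ℝ (Fin T)) : ℝ := if h : k < T then x ⟨k, h⟩ else 0

/-- The coordinate before `k`, with the value `1` before the first one. -/
def prevCoord : ℕ → EuclideanSpace ℝ (Fin T) → ℝ
  | 0, _ => 1
  | k + 1, x => coord k x

/-- The weighted chain-like hard function: its `k`-th term couples the coordinates `k - 1`
and `k`. -/
noncomputable def chainFun (w : ℕ → ℝ) (x : EuclideanSpace ℝ (Fin T)) : ℝ :=
  ∑ k ∈ Finset.range T,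
    w k * (min (coord k x) 0 ^ 2 / 2 - tentStep (prevCoord k x) * tentStep (coord k x + 1))

/-- The partial derivative of `chainFun w` with respect to the coordinate `k`. -/
noncomputable def chainPartial (w : ℕ → ℝ) (k : ℕ) (x : EuclideanSpace ℝ (Fin T)) : ℝ :=
  w k * (min (coord k x) 0 - tentStep (prevCoord k x) * tent (coord k x + 1)) -
    w (k + 1) * (tent (coord k x) * tentStep (coord (k + 1) x + 1))

/-- The gradient of `chainFun w`. -/
noncomputable def chainGrad (w : ℕ → ℝ) (x : EuclideanSpace ℝ (Fin T)) :
    EuclideanSpace ℝ (Fin T) :=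
  WithLp.toLp 2 fun i => chainPartial w i x

@[simp] theorem chainGrad_apply (w : ℕ → ℝ) (x : EuclideanSpace ℝ (Fin T)) (i : Fin T) :
    chainGrad w x i = chainPartial w i x := rfl

theorem coord_fin (i : Fin T) (x : EuclideanSpace ℝ (Fin T)) : coord (i : ℕ) x = x i := by
  simp [coord]

@[simp] theorem coord_zero_vec (k : ℕ) : coord k (0 : EuclideanSpace ℝ (Fin T)) = 0 := by
  simp [coord]

theorem coord_sub (k : ℕ) (x y : EuclideanSpace ℝ (Fin T)) :
    coord k (x - y) = coord k x - coord k y := by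
  unfold coord; split_ifs <;> simp

theorem coord_smul (k : ℕ) (b : ℝ) (x : EuclideanSpace ℝ (Fin T)) :
    coord k (b • x) = b * coord k x := by
  unfold coord; split_ifs <;> simp

/-- The coordinate `k` as a continuous linear functional. -/
noncomputable def coordCLM (k : ℕ) : EuclideanSpace ℝ (Fin T) →L[ℝ] ℝ :=
  if h : k < T then EuclideanSpace.proj ⟨k, h⟩ else 0

theorem coordCLM_apply (k : ℕ) (x : EuclideanSpace ℝ (Fin T)) : coordCLM k x = coord k x := by
  unfold coordCLM coord; split_ifs <;> simp

theorem hasFDerivAt_coord (k : ℕ) (x : EuclideanSpace ℝ (Fin T)) :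
    HasFDerivAt (coord k) (coordCLM k) x := by
  have h := (coordCLM (T := T) k).hasFDerivAt (x := x)
  rwa [show (⇑(coordCLM (T := T) k)) = coord k from funext (coordCLM_apply k)] at h

/-- The derivative of `prevCoord k`. -/
noncomputable def prevCoordCLM : ℕ → EuclideanSpace ℝ (Fin T) →L[ℝ] ℝ
  | 0 => 0
  | k + 1 => coordCLM k

theorem hasFDerivAt_prevCoord (k : ℕ) (x : EuclideanSpace ℝ (Fin T)) :
    HasFDerivAt (prevCoord k) (prevCoordCLM k) x := by
  cases k with
  | zero => exact hasFDerivAt_const (1 : ℝ) x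
  | succ k => exact hasFDerivAt_coord k x

theorem sum_range_coord_sq (x : EuclideanSpace ℝ (Fin T)) :
    ∑ k ∈ Finset.range T, coord k x ^ 2 = ‖x‖ ^ 2 := by
  rw [EuclideanSpace.norm_sq_eq, ← Fin.sum_univ_eq_sum_range (fun k => coord k x ^ 2)]
  simp [coord_fin]

theorem norm_chainGrad_sub_sq (w : ℕ → ℝ) (x y : EuclideanSpace ℝ (Fin T)) :
    ‖chainGrad w x - chainGrad w y‖ ^ 2 =
      ∑ k ∈ Finset.range T, (chainPartial w k x - chainPartial w k y) ^ 2 := by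
  rw [EuclideanSpace.norm_sq_eq,
    ← Fin.sum_univ_eq_sum_range (fun k => (chainPartial w k x - chainPartial w k y) ^ 2)]
  simp

/-- Coordinate k occurs in the terms k and k + 1. Collecting the latter shifts an index and leaves a
boundary term at T, which `hw` removes. -/
theorem chainFun_hasGradientAt {w : ℕ → ℝ} (hw : w T = 0) (x : EuclideanSpace ℝ (Fin T)) :
    HasGradientAt (chainFun w) (chainGrad w x) x := by
  rw [hasGradientAt_iff_hasFDerivAt]
  have hterm : ∀ k ∈ Finset.range T, HasFDerivAt (fun x : EuclideanSpace ℝ (Fin T) =>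
      w k * (min (coord k x) 0 ^ 2 / 2 - tentStep (prevCoord k x) * tentStep (coord k x + 1)))
      (w k • (min (coord k x) 0 • coordCLM k -
        (tentStep (prevCoord k x) • (tent (coord k x + 1) • coordCLM k) +
          tentStep (coord k x + 1) • (tent (prevCoord k x) • prevCoordCLM k)))) x := by
    intro k _
    have h1 := (hasDerivAt_min_zero_sq (coord k x)).comp_hasFDerivAt x (hasFDerivAt_coord k x)
    have h2 := (hasDerivAt_tentStep (prevCoord k x)).comp_hasFDerivAt x (hasFDerivAt_prevCoord k x)
    have h3 := (hasDerivAt_tentStep (coord k x + 1)).comp_hasFDerivAt x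
      ((hasFDerivAt_coord k x).add_const 1)
    exact (h1.sub (h2.mul h3)).const_mul (w k)
  refine (HasFDerivAt.fun_sum hterm).congr_fderiv ?_
  ext1 v
  have hshift : ∑ k ∈ Finset.range T, w k * (tentStep (coord k x + 1) * (tent (prevCoord k x) *
        prevCoordCLM k v)) =
      ∑ k ∈ Finset.range T, w (k + 1) * (tentStep (coord (k + 1) x + 1) * (tent (coord k x) *
        coord k v)) := by
    have h := Finset.sum_range_succ' (fun k => w k * (tentStep (coord k x + 1) *
      (tent (prevCoord k x) * prevCoordCLM k v))) T
    rw [Finset.sum_range_succ, hw] at h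
    simpa [prevCoordCLM, prevCoord, coordCLM_apply] using h
  have hinner : InnerProductSpace.toDual ℝ (EuclideanSpace ℝ (Fin T)) (chainGrad w x) v =
      ∑ k ∈ Finset.range T, chainPartial w k x * coord k v := by
    rw [InnerProductSpace.toDual_apply_apply, PiLp.inner_apply,
      ← Fin.sum_univ_eq_sum_range (fun k => chainPartial w k x * coord k v)]
    simp [coord_fin, mul_comm]
  rw [hinner, sum_apply]
  have hexp : ∀ k, (w k • (min (coord k x) 0 • coordCLM k -
        (tentStep (prevCoord k x) • (tent (coord k x + 1) • coordCLM k) +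
          tentStep (coord k x + 1) • (tent (prevCoord k x) • prevCoordCLM k))) :
          EuclideanSpace ℝ (Fin T) →L[ℝ] ℝ) v =
      w k * (min (coord k x) 0 - tentStep (prevCoord k x) * tent (coord k x + 1)) * coord k v -
        w k * (tentStep (coord k x + 1) * (tent (prevCoord k x) * prevCoordCLM k v)) := by
    intro k
    simp only [smul_apply, sub_apply,
      add_apply, smul_eq_mul, coordCLM_apply]
    ring
  simp_rw [hexp]
  rw [Finset.sum_sub_distrib, hshift, ← Finset.sum_sub_distrib]
  refine Finset.sum_congr rfl fun k _ => ?_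
  simp only [chainPartial]
  ring

theorem abs_mul_sub_mul_le {a b c d : ℝ} (ha : |a| ≤ 1) (hd : |d| ≤ 1) :
    |a * b - c * d| ≤ |a - c| + |b - d| := by
  have : a * b - c * d = (a - c) * d + a * (b - d) := by ring
  rw [this]
  refine (abs_add_le _ _).trans ?_
  rw [abs_mul, abs_mul]
  have h1 := mul_le_mul_of_nonneg_left hd (abs_nonneg (a - c))
  have h2 := mul_le_mul_of_nonneg_right ha (abs_nonneg (b - d))
  linarith

theorem abs_chainPartial_sub_le {w : ℕ → ℝ} {M : ℝ} (hw : ∀ k, |w k| ≤ M) (k : ℕ)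
    (x y : EuclideanSpace ℝ (Fin T)) :
    |chainPartial w k x - chainPartial w k y| ≤
      3 * M * (|prevCoord k x - prevCoord k y| + |coord k x - coord k y| +
        |coord (k + 1) x - coord (k + 1) y|) := by
  have hM : 0 ≤ M := (abs_nonneg _).trans (hw 0)
  have h1 : |min (coord k x) 0 - min (coord k y) 0| ≤ |coord k x - coord k y| :=
    (abs_min_sub_min_le_max _ _ _ _).trans (by simp)
  have h2 : |tentStep (prevCoord k x) * tent (coord k x + 1) -
      tentStep (prevCoord k y) * tent (coord k y + 1)| ≤
      |prevCoord k x - prevCoord k y| + |coord k x - coord k y| := by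
    refine (abs_mul_sub_mul_le (abs_tentStep_le_one _) (abs_tent_le_one _)).trans ?_
    have := abs_tent_sub_le (coord k x + 1) (coord k y + 1)
    rw [add_sub_add_right_eq_sub] at this
    exact add_le_add (abs_tentStep_sub_le _ _) this
  have h3 : |tent (coord k x) * tentStep (coord (k + 1) x + 1) -
      tent (coord k y) * tentStep (coord (k + 1) y + 1)| ≤
      |coord k x - coord k y| + |coord (k + 1) x - coord (k + 1) y| := by
    refine (abs_mul_sub_mul_le (abs_tent_le_one _) (abs_tentStep_le_one _)).trans ?_
    have := abs_tentStep_sub_le (coord (k + 1) x + 1) (coord (k + 1) y + 1)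
    rw [add_sub_add_right_eq_sub] at this
    exact add_le_add (abs_tent_sub_le _ _) this
  have hsplit : chainPartial w k x - chainPartial w k y =
      w k * ((min (coord k x) 0 - min (coord k y) 0) -
        (tentStep (prevCoord k x) * tent (coord k x + 1) -
          tentStep (prevCoord k y) * tent (coord k y + 1))) -
      w (k + 1) * (tent (coord k x) * tentStep (coord (k + 1) x + 1) -
        tent (coord k y) * tentStep (coord (k + 1) y + 1)) := by
    simp only [chainPartial]; ring
  rw [hsplit]
  refine (abs_sub _ _).trans ?_
  rw [abs_mul, abs_mul]
  have h4 := (abs_sub (min (coord k x) 0 - min (coord k y) 0)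
    (tentStep (prevCoord k x) * tent (coord k x + 1) -
      tentStep (prevCoord k y) * tent (coord k y + 1))).trans (add_le_add h1 h2)
  have h5 := mul_le_mul (hw k) h4 (abs_nonneg _) hM
  have h6 := mul_le_mul (hw (k + 1)) h3 (abs_nonneg _) hM
  have h7 := mul_nonneg hM (abs_nonneg (prevCoord k x - prevCoord k y))
  have h8 := mul_nonneg hM (abs_nonneg (coord (k + 1) x - coord (k + 1) y))
  nlinarith

/-- A partial derivative involves three neighbouring coordinates, so each squared difference is
counted at most three times; with Cauchy–Schwarz for three terms, (3M)² · 3 · 3 = (9M)². -/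
theorem chainGrad_lipschitz {w : ℕ → ℝ} {M : ℝ} (hw : ∀ k, |w k| ≤ M)
    (x y : EuclideanSpace ℝ (Fin T)) :
    ‖chainGrad w x - chainGrad w y‖ ≤ 9 * M * ‖x - y‖ := by
  have hM : 0 ≤ M := (abs_nonneg _).trans (hw 0)
  refine le_of_sq_le_sq ?_ (by positivity)
  rw [norm_chainGrad_sub_sq]
  have hs0 := sum_range_coord_sq (x - y)
  have hs1 : ∑ k ∈ Finset.range T, (prevCoord k x - prevCoord k y) ^ 2 ≤ ‖x - y‖ ^ 2 := by
    rw [← hs0]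
    cases T with
    | zero => simp
    | succ N =>
      rw [Finset.sum_range_succ', Finset.sum_range_succ]
      simp only [prevCoord, coord_sub, sub_self]
      have := sq_nonneg (coord N x - coord N y)
      linarith
  have hs2 : ∑ k ∈ Finset.range T, coord (k + 1) (x - y) ^ 2 ≤ ‖x - y‖ ^ 2 := by
    rw [← hs0]
    have h := Finset.sum_range_succ' (fun k => coord k (x - y) ^ 2) T
    rw [Finset.sum_range_succ] at h
    have h1 : coord T (x - y) = 0 := by simp [coord]
    rw [h1] at h
    have := sq_nonneg (coord 0 (x - y))
    linarith
  calc ∑ k ∈ Finset.range T, (chainPartial w k x - chainPartial w k y) ^ 2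
      ≤ ∑ k ∈ Finset.range T, 27 * M ^ 2 * ((prevCoord k x - prevCoord k y) ^ 2 +
          coord k (x - y) ^ 2 + coord (k + 1) (x - y) ^ 2) := by
        refine Finset.sum_le_sum fun k _ => ?_
        have h := abs_chainPartial_sub_le hw k x y
        rw [← coord_sub, ← coord_sub] at h
        rw [← sq_abs]
        refine (pow_le_pow_left₀ (abs_nonneg _) h 2).trans ?_
        rw [mul_pow, mul_pow, ← sq_abs (prevCoord k x - prevCoord k y), ← sq_abs (coord k (x - y)),
          ← sq_abs (coord (k + 1) (x - y))]
        set a := |prevCoord k x - prevCoord k y|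
        set b := |coord k (x - y)|
        set c := |coord (k + 1) (x - y)|
        have : (a + b + c) ^ 2 ≤ 3 * (a ^ 2 + b ^ 2 + c ^ 2) := by
          nlinarith [sq_nonneg (a - b), sq_nonneg (b - c), sq_nonneg (a - c)]
        nlinarith [mul_le_mul_of_nonneg_left this (sq_nonneg M)]
    _ ≤ 27 * M ^ 2 * (3 * ‖x - y‖ ^ 2) := by
        rw [← Finset.mul_sum, Finset.sum_add_distrib, Finset.sum_add_distrib, hs0]
        exact mul_le_mul_of_nonneg_left (by linarith) (by positivity)
    _ = (9 * M * ‖x - y‖) ^ 2 := by ring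

/-- The vectors all of whose coordinates from `m` on vanish. -/
def headSpace (T m : ℕ) : Submodule ℝ (EuclideanSpace ℝ (Fin T)) where
  carrier := {x | ∀ k, m ≤ k → coord k x = 0}
  add_mem' := by
    intro x y hx hy k hk
    have h1 := hx k hk
    have h2 := hy k hk
    unfold coord at *
    split_ifs at * <;> simp_all
  zero_mem' := by intro k _; simp
  smul_mem' := by
    intro b x hx k hk
    rw [coord_smul, hx k hk, mul_zero]

theorem headSpace_mono {m m' : ℕ} (h : m ≤ m') : headSpace T m ≤ headSpace T m' :=
  fun _ hx k hk => hx k (h.trans hk)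

theorem mem_headSpace_iff_fin {m : ℕ} {x : EuclideanSpace ℝ (Fin T)} :
    x ∈ headSpace T m ↔ ∀ i : Fin T, m ≤ i → x i = 0 := by
  refine ⟨fun h i hi => by rw [← coord_fin]; exact h i hi, fun h k hk => ?_⟩
  unfold coord
  split_ifs with hkT
  · exact h ⟨k, hkT⟩ hk
  · rfl

theorem prevCoord_eq_zero {m k : ℕ} {x : EuclideanSpace ℝ (Fin T)} (hx : x ∈ headSpace T m)
    (hk : m < k) : prevCoord k x = 0 := by
  cases k with
  | zero => omega
  | succ k => exact hx k (by omega)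

/-- Beyond the first undiscovered coordinate all couplings are flat, because `tentStep` and `tent`
both vanish at 0; thus a gradient discovers at most one coordinate. -/
theorem chainPartial_eq_zero (w : ℕ → ℝ) {m k : ℕ} {x : EuclideanSpace ℝ (Fin T)}
    (hx : x ∈ headSpace T m) (hk : m < k) : chainPartial w k x = 0 := by
  simp [chainPartial, hx k hk.le, prevCoord_eq_zero hx hk]

theorem chainPartial_of_mem_headSpace (w : ℕ → ℝ) {m : ℕ} {x : EuclideanSpace ℝ (Fin T)}
    (hx : x ∈ headSpace T m) : chainPartial w m x = - (w m * tentStep (prevCoord m x)) := by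
  simp [chainPartial, hx m le_rfl, tent_one]

theorem chainGrad_mem_headSpace (w : ℕ → ℝ) {m : ℕ} {x : EuclideanSpace ℝ (Fin T)}
    (hx : x ∈ headSpace T m) : chainGrad w x ∈ headSpace T (m + 1) :=
  mem_headSpace_iff_fin.2 fun _ hi => chainPartial_eq_zero w hx hi

/-- A node that does not own the term m cannot discover the coordinate m. This is what makes it
costly to distribute the chain over distant nodes. -/
theorem chainGrad_mem_headSpace_of_weight_eq_zero {w : ℕ → ℝ} {m : ℕ}
    {x : EuclideanSpace ℝ (Fin T)} (hx : x ∈ headSpace T m) (hw : w m = 0) :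
    chainGrad w x ∈ headSpace T m := by
  refine mem_headSpace_iff_fin.2 fun i hi => ?_
  rcases hi.eq_or_lt with h | h
  · rw [chainGrad_apply, ← h, chainPartial_of_mem_headSpace w hx, hw]; simp
  · exact chainPartial_eq_zero w hx h

/-- The unit weights on the indices below the dimension. -/
def unitWeight (T : ℕ) : ℕ → ℝ := fun k => if k < T then 1 else 0

/-- Every term is at most 0 at the origin and at least -1 everywhere. -/
theorem chainFun_gap (x : EuclideanSpace ℝ (Fin T)) :
    chainFun (unitWeight T) (0 : EuclideanSpace ℝ (Fin T)) - chainFun (unitWeight T) x ≤ T := by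
  rw [chainFun, chainFun, ← Finset.sum_sub_distrib]
  calc _ ≤ ∑ k ∈ Finset.range T, (1 : ℝ) := by
        refine Finset.sum_le_sum fun k hk => ?_
        have hk' : unitWeight T k = 1 := if_pos (Finset.mem_range.1 hk)
        rw [hk']
        have h1 := mul_nonneg (tentStep_nonneg (prevCoord k (0 : EuclideanSpace ℝ (Fin T))))
          (tentStep_nonneg (coord k (0 : EuclideanSpace ℝ (Fin T)) + 1))
        have h2 := mul_le_one₀ (tentStep_le_one (prevCoord k x)) (tentStep_nonneg (coord k x + 1))
          (tentStep_le_one (coord k x + 1))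
        have h3 : 0 ≤ min (coord k x) 0 ^ 2 := sq_nonneg _
        simp only [coord_zero_vec, min_self, one_mul, zero_pow two_ne_zero, zero_div] at h1 ⊢
        have h4 : ∀ {A B C : ℝ}, 0 ≤ A → C ≤ 1 → 0 ≤ B → 0 - A - (B / 2 - C) ≤ 1 := by
          intro A B C hA hC hB; linarith
        exact h4 h1 h2 h3
    _ = T := by simp

theorem tentStep_half : tentStep (1 / 2) = 1 / 8 := by norm_num [tentStep]

/-- As long as some coordinate vanishes, the gradient of the chain function is not small. -/
theorem le_norm_chainGrad {x : EuclideanSpace ℝ (Fin T)} (hT : 0 < T)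
    (hx : x ∈ headSpace T (T - 1)) : 1 / 16 ≤ ‖chainGrad (unitWeight T) x‖ := by
  classical
  -- The partial derivative at the first coordinate below 1/2 is the large one: its predecessor is
  -- at least 1/2, so the coupling between them is switched on.
  have hex : ∃ k, coord k x < 1 / 2 := ⟨T - 1, by rw [hx _ le_rfl]; norm_num⟩
  set k := Nat.find hex with hk
  have hk1 : coord k x < 1 / 2 := Nat.find_spec hex
  have hkT : k < T := lt_of_le_of_lt (Nat.find_min' hex (by rw [hx _ le_rfl]; norm_num))
    (Nat.sub_lt hT one_pos)
  have hprev : 1 / 2 ≤ prevCoord k x := by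
    rcases Nat.eq_zero_or_pos k with h0 | h0
    · rw [h0]; simp only [prevCoord]; norm_num
    · obtain ⟨l, hl⟩ : ∃ l, k = l + 1 := ⟨k - 1, by omega⟩
      rw [hl]
      exact not_lt.1 (Nat.find_min hex (by omega : l < Nat.find hex))
  have hstep : 1 / 8 ≤ tentStep (prevCoord k x) := by
    rw [← tentStep_half]; exact tentStep_monotone hprev
  have hw1 : unitWeight T k = 1 := if_pos hkT
  have hw2 : 0 ≤ unitWeight T (k + 1) := by unfold unitWeight; split_ifs <;> norm_num
  have hneg : chainPartial (unitWeight T) k x ≤ -(1 / 16) := by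
    rw [chainPartial, hw1, one_mul]
    have h1 := mul_nonneg hw2 (mul_nonneg (tent_nonneg (coord k x))
      (tentStep_nonneg (coord (k + 1) x + 1)))
    -- Far to the left the quadratic supplies the slope; otherwise the coupling does, with 1/8 · 1/2
    -- = 1/16. All contributions have the same sign, so nothing cancels.
    rcases le_total (coord k x) (-(1 / 2)) with h2 | h2
    · have h3 : min (coord k x) 0 ≤ -(1 / 2) := (min_le_left _ _).trans h2
      have h4 := mul_nonneg (tentStep_nonneg (prevCoord k x)) (tent_nonneg (coord k x + 1))
      linarith
    · have h3 : min (coord k x) 0 ≤ 0 := min_le_right _ _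
      have h4 : 1 / 2 ≤ tent (coord k x + 1) := by
        rw [tent_eq]
        exact le_max_of_le_left (le_min (by linarith) (by linarith))
      have h5 := mul_le_mul hstep h4 (by norm_num) (tentStep_nonneg (prevCoord k x))
      linarith
  have h := PiLp.norm_apply_le (chainGrad (unitWeight T) x) ⟨k, hkT⟩
  rw [chainGrad_apply, Real.norm_eq_abs] at h
  refine le_trans ?_ h
  rw [le_abs]
  right
  simpa using by linarith

end Chain

/-! ### Rescaling to smoothness L and gap Δ -/

section ScaledChain

variable {T : ℕ}

/-- The weighted chain function, rescaled to smoothness `L` and gap `Δ`. -/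
noncomputable def scaledChain (L Δ : ℝ) (w : ℕ → ℝ) (x : EuclideanSpace ℝ (Fin T)) : ℝ :=
  Δ / T * chainFun w (Real.sqrt (L * T / (27 * Δ)) • x)

/-- The gradient of `scaledChain L Δ w`. -/
noncomputable def scaledChainGrad (L Δ : ℝ) (w : ℕ → ℝ) (x : EuclideanSpace ℝ (Fin T)) :
    EuclideanSpace ℝ (Fin T) :=
  (Δ / T * Real.sqrt (L * T / (27 * Δ))) • chainGrad w (Real.sqrt (L * T / (27 * Δ)) • x)

theorem scaledChain_hasGradientAt (L Δ : ℝ) {w : ℕ → ℝ} (hw : w T = 0)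
    (x : EuclideanSpace ℝ (Fin T)) :
    HasGradientAt (scaledChain L Δ w) (scaledChainGrad L Δ w x) x := by
  set b := Real.sqrt (L * T / (27 * Δ)) with hb
  have h := (chainFun_hasGradientAt hw (b • x)).hasFDerivAt
  have h1 : HasFDerivAt (fun x : EuclideanSpace ℝ (Fin T) => b • x)
      (b • ContinuousLinearMap.id ℝ (EuclideanSpace ℝ (Fin T))) x :=
    (b • ContinuousLinearMap.id ℝ (EuclideanSpace ℝ (Fin T))).hasFDerivAt
  rw [hasGradientAt_iff_hasFDerivAt]
  refine ((h.comp x h1).const_mul (Δ / T)).congr_fderiv ?_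
  ext1 v
  simp [scaledChainGrad, ← hb]
  ring

theorem gradient_scaledChain (L Δ : ℝ) {w : ℕ → ℝ} (hw : w T = 0)
    (x : EuclideanSpace ℝ (Fin T)) :
    gradient (scaledChain L Δ w) x = scaledChainGrad L Δ w x :=
  (scaledChain_hasGradientAt L Δ hw x).gradient

theorem scaledChainGrad_factor_sq {L Δ : ℝ} (hL : 0 < L) (hΔ : 0 < Δ) (hT : 0 < T) :
    (Δ / T * Real.sqrt (L * T / (27 * Δ))) ^ 2 = L * Δ / (27 * T) := by
  have : (0 : ℝ) < T := by exact_mod_cast hT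
  rw [mul_pow, Real.sq_sqrt (by positivity)]
  field_simp

theorem avgFun_scaledChain {n : ℕ} (hn : 0 < n) (L Δ : ℝ) {w : Fin n → ℕ → ℝ}
    (havg : ∀ k < T, ∑ i, w i k = n) :
    avgFun (fun i => scaledChain (T := T) L Δ (w i)) = scaledChain L Δ (unitWeight T) := by
  have hn' : (n : ℝ) ≠ 0 := by positivity
  funext x
  simp only [avgFun, scaledChain, chainFun]
  rw [← Finset.mul_sum, Finset.sum_comm]
  simp_rw [← Finset.sum_mul]
  rw [mul_left_comm, Finset.mul_sum]
  congr 1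
  refine Finset.sum_congr rfl fun k hk => ?_
  have hk := Finset.mem_range.1 hk
  rw [havg k hk, ← mul_assoc, inv_mul_cancel₀ hn', unitWeight, if_pos hk]

theorem unitWeight_self : unitWeight T T = 0 := by simp [unitWeight]

/-- Weights up to 3 make the chain gradient 27-Lipschitz, whence the 27 in the scaling; the gap T is
rescaled by Δ/T. -/
theorem scaledChain_inFunctionClass {n : ℕ} (hn : 0 < n) {L Δ : ℝ} (hL : 0 < L) (hΔ : 0 < Δ)
    (hT : 0 < T) {w : Fin n → ℕ → ℝ} (hw : ∀ i k, |w i k| ≤ 3) (hwT : ∀ i, w i T = 0)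
    (havg : ∀ k < T, ∑ i, w i k = n) :
    InFunctionClass L Δ (0 : EuclideanSpace ℝ (Fin T))
      (fun i => scaledChain (T := T) L Δ (w i)) := by
  have hT' : (0 : ℝ) < T := by exact_mod_cast hT
  refine ⟨fun i x => (scaledChain_hasGradientAt L Δ (hwT i) x).differentiableAt,
    fun i x y => ?_, fun x => ?_⟩
  · rw [gradient_scaledChain L Δ (hwT i), gradient_scaledChain L Δ (hwT i), scaledChainGrad,
      scaledChainGrad, ← smul_sub, norm_smul, Real.norm_eq_abs, abs_of_nonneg (by positivity)]
    set b := Real.sqrt (L * T / (27 * Δ)) with hb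
    have hb0 : 0 ≤ b := Real.sqrt_nonneg _
    have h := chainGrad_lipschitz (hw i) (b • x) (b • y)
    rw [← smul_sub, norm_smul, Real.norm_eq_abs, abs_of_nonneg hb0] at h
    calc _ ≤ Δ / T * b * (9 * 3 * (b * ‖x - y‖)) := mul_le_mul_of_nonneg_left h (by positivity)
      _ = 27 * Δ / T * b ^ 2 * ‖x - y‖ := by ring
      _ = L * ‖x - y‖ := by
        rw [hb, Real.sq_sqrt (by positivity)]
        field_simp
  · rw [avgFun_scaledChain hn L Δ havg, scaledChain, scaledChain, smul_zero, ← mul_sub]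
    refine (mul_le_mul_of_nonneg_left (chainFun_gap _) (by positivity)).trans (le_of_eq ?_)
    field_simp

/-- The squared scaling factor is LΔ/(27T), and 6912 = 27 · 16². -/
theorem le_norm_gradient_scaledChain_sq {L Δ : ℝ} (hL : 0 < L) (hΔ : 0 < Δ) (hT : 0 < T)
    {x : EuclideanSpace ℝ (Fin T)} (hx : x ∈ headSpace T (T - 1)) :
    L * Δ / (6912 * T) ≤ ‖gradient (scaledChain L Δ (unitWeight T)) x‖ ^ 2 := by
  rw [gradient_scaledChain L Δ unitWeight_self, scaledChainGrad, norm_smul, mul_pow,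
    Real.norm_eq_abs, sq_abs, scaledChainGrad_factor_sq hL hΔ hT]
  have h := pow_le_pow_left₀ (by norm_num) (le_norm_chainGrad hT
    (Submodule.smul_mem _ (Real.sqrt (L * T / (27 * Δ))) hx)) 2
  have hT' : (0 : ℝ) < T := by exact_mod_cast hT
  calc L * Δ / (6912 * T) = L * Δ / (27 * T) * (1 / 16) ^ 2 := by field_simp; norm_num
    _ ≤ _ := mul_le_mul_of_nonneg_left h (by positivity)

theorem scaledChainGrad_mem_headSpace (L Δ : ℝ) (w : ℕ → ℝ) {m : ℕ} {x : EuclideanSpace ℝ (Fin T)}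
    (hx : x ∈ headSpace T m) : scaledChainGrad L Δ w x ∈ headSpace T (m + 1) :=
  Submodule.smul_mem _ _ (chainGrad_mem_headSpace w (Submodule.smul_mem _ _ hx))

theorem scaledChainGrad_mem_headSpace_of_weight_eq_zero (L Δ : ℝ) {w : ℕ → ℝ} {m : ℕ}
    {x : EuclideanSpace ℝ (Fin T)} (hx : x ∈ headSpace T m) (hw : w m = 0) :
    scaledChainGrad L Δ w x ∈ headSpace T m :=
  Submodule.smul_mem _ _ (chainGrad_mem_headSpace_of_weight_eq_zero (Submodule.smul_mem _ _ hx) hw)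

theorem continuous_scaledChainGrad (L Δ : ℝ) {w : ℕ → ℝ} (hw : ∀ k, |w k| ≤ 3) :
    Continuous (scaledChainGrad (T := T) L Δ w) := by
  have h : Continuous (chainGrad (T := T) w) :=
    (LipschitzWith.of_dist_le_mul (K := 27) fun x y => by
      rw [dist_eq_norm, dist_eq_norm]
      refine (chainGrad_lipschitz hw x y).trans (le_of_eq ?_)
      norm_num).continuous
  exact (h.comp (continuous_const_smul (Real.sqrt (L * T / (27 * Δ))))).const_smul
    (Δ / T * Real.sqrt (L * T / (27 * Δ)))

end ScaledChain

/-! ### Network lower bound -/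

/-- If the iterates of a linear-spanning run lie in a subspace, so does its output. -/
theorem IsLinearSpanningRun.output_mem_of_iterate_mem {n d : ℕ} {W : Matrix (Fin n) (Fin n) ℝ}
    {R K : ℕ} {x₀ : EuclideanSpace ℝ (Fin d)} {O : StochasticOracles n d} {Ω : Type*}
    [MeasurableSpace Ω] {μ : Measure Ω} {ξ : ℕ → Fin n → Ω → O.Ξ}
    {x : ℕ → Fin n → Ω → EuclideanSpace ℝ (Fin d)} {xhat : Ω → EuclideanSpace ℝ (Fin d)}
    (h : IsLinearSpanningRun W R K x₀ O μ ξ x xhat) {V : Submodule ℝ (EuclideanSpace ℝ (Fin d))}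
    {ω : Ω} (hV : ∀ k ≤ K, ∀ i, x k i ω ∈ V) : xhat ω ∈ V := by
  refine Submodule.span_le.2 ?_ (h.output_mem ω)
  rintro _ ⟨k, hk, i, rfl⟩
  exact hV k hk i

/-- The noise-free oracle. -/
noncomputable def exactOracle {n d : ℕ} (G : Fin n → EuclideanSpace ℝ (Fin d) →
    EuclideanSpace ℝ (Fin d)) (hG : ∀ i, Measurable (G i)) : StochasticOracles n d where
  Ξ := Unit
  law := fun _ => Measure.dirac ()
  grad := fun i x _ => G i x
  measurable_grad := fun i => (hG i).comp measurable_fst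

theorem exactOracle_inOracleClass {n d : ℕ} {f : Fin n → EuclideanSpace ℝ (Fin d) → ℝ}
    {G : Fin n → EuclideanSpace ℝ (Fin d) → EuclideanSpace ℝ (Fin d)}
    (hG : ∀ i, Measurable (G i)) (hfG : ∀ i x, gradient (f i) x = G i x) (σ : ℝ) :
    InOracleClass σ f (exactOracle G hG) where
  integrable := fun i x => integrable_const (G i x)
  unbiased := fun i x => by
    rw [show (exactOracle G hG).grad i x = fun _ => G i x from rfl, hfG]; simp
  integrable_sq := fun i x => by
    rw [show (exactOracle G hG).grad i x = fun _ => G i x from rfl, hfG]; simp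
  variance := fun i x => by
    rw [show (exactOracle G hG).grad i x = fun _ => G i x from rfl, hfG]; simp [sq_nonneg]

/-- An upper bound for the number of discovered coordinates at node `i` after `t` rounds of gossip,
if the even coordinates are served by the nodes up to `a` and the odd ones by the nodes from
`a + D` on. -/
def splitBound (a D t i : ℕ) : ℕ := 2 * (t / D) + if i ≤ a + t % D then 1 else 0

/-- Within a period of D rounds the front `a + t % D` climbs by one per round, as fast as
information does. At the end of a period the bound generously credits every node with both
coordinates and restarts the front at `a`. -/
theorem splitBound_gossip {a D t i j : ℕ} (hD : 0 < D) (hij : i ≤ j + 1) :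
    splitBound a D t j ≤ splitBound a D (t + 1) i := by
  unfold splitBound
  have h1 := Nat.div_add_mod t D
  have h2 := Nat.div_add_mod (t + 1) D
  have h3 := Nat.mod_lt t hD
  have h4 := Nat.mod_lt (t + 1) hD
  rcases Nat.lt_or_ge (t % D + 1) D with h | h
  · have h5 : (t + 1) / D = t / D := by
      refine Nat.div_eq_of_lt_le ?_ ?_ <;> simp only [add_mul, mul_comm (t / D)] <;> omega
    have h6 : (t + 1) % D = t % D + 1 := by
      rw [h5] at h2; omega
    rw [h5, h6]
    split_ifs <;> omega
  · have h5 : (t + 1) / D = t / D + 1 := by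
      refine Nat.div_eq_of_lt_le ?_ ?_ <;> simp only [add_mul, mul_comm (t / D)] <;> omega
    rw [h5]
    split_ifs <;> omega

theorem splitBound_le (a D : ℕ) {t t' : ℕ} (h : t ≤ t') (i : ℕ) :
    splitBound a D t i ≤ 2 * (t' / D) + 1 := by
  unfold splitBound
  have := Nat.div_le_div_right (c := D) h
  split_ifs <;> omega

/-- If the gradients at the nodes respect the bound at every time, so do the memories. -/
theorem memory_le_headSpace_splitBound {n T : ℕ} {W : Matrix (Fin n) (Fin n) ℝ}
    (hW : ∀ i j, W i j ≠ 0 → (i : ℕ) ≤ j + 1) {a D : ℕ} (hD : 0 < D) (R K : ℕ)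
    {g : ℕ → Fin n → EuclideanSpace ℝ (Fin T)}
    (hg : ∀ k < K, ∀ i, memory W R 0 g k i ≤ headSpace T (splitBound a D (k * R) i) →
      g k i ∈ headSpace T (splitBound a D (k * R) i)) :
    ∀ k ≤ K, ∀ i, memory W R 0 g k i ≤ headSpace T (splitBound a D (k * R) i) := by
  have hgossip : ∀ (r t : ℕ) (M : Fin n → Submodule ℝ (EuclideanSpace ℝ (Fin T))),
      (∀ i, M i ≤ headSpace T (splitBound a D t i)) →
      ∀ i, (gossip W)^[r] M i ≤ headSpace T (splitBound a D (t + r) i) := by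
    intro r
    induction r with
    | zero => intro t M hM i; exact hM i
    | succ r ih =>
      intro t M hM i
      rw [Function.iterate_succ_apply, show t + (r + 1) = t + 1 + r by omega]
      refine ih (t + 1) _ (fun i => ?_) i
      refine sup_le ((hM i).trans (headSpace_mono (splitBound_gossip hD (by omega)))) ?_
      exact iSup₂_le fun j hj => (hM j).trans (headSpace_mono (splitBound_gossip hD (hW i j hj)))
  intro k
  induction k with
  | zero => intro _ i; simp [memory]
  | succ k ih =>
    intro hk i
    have hk' := ih (by omega)
    rw [Nat.succ_mul]
    refine hgossip R (k * R) _ (fun i => sup_le (hk' i) ?_) i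
    rw [Submodule.span_singleton_le_iff_mem]
    exact hg k (by omega) i (hk' i)

/-- There are a function in the class with parameters `L` and `Δ` and an oracle of variance `σ²`
that keep the expected squared gradient norm of every linear-spanning algorithm above `b`. -/
def AdmitsHardInstance.{u} {n : ℕ} (W : Matrix (Fin n) (Fin n) ℝ) (R K : ℕ) (L Δ σ b : ℝ) :
    Prop :=
  ∃ (d : ℕ) (x₀ : EuclideanSpace ℝ (Fin d)) (f : Fin n → EuclideanSpace ℝ (Fin d) → ℝ)
    (O : StochasticOracles n d),
    0 < d ∧ InFunctionClass L Δ x₀ f ∧ InOracleClass σ f O ∧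
    ∀ (Ω : Type u) [MeasurableSpace Ω] (μ : Measure Ω) [IsProbabilityMeasure μ]
      (ξ : ℕ → Fin n → Ω → O.Ξ) (x : ℕ → Fin n → Ω → EuclideanSpace ℝ (Fin d))
      (xhat : Ω → EuclideanSpace ℝ (Fin d)),
      IsLinearSpanningRun W R K x₀ O μ ξ x xhat →
      ENNReal.ofReal b ≤ ∫⁻ ω, ENNReal.ofReal (‖gradient (avgFun f) (xhat ω)‖ ^ 2) ∂μ

theorem AdmitsHardInstance.mono.{u} {n : ℕ} {W : Matrix (Fin n) (Fin n) ℝ} {R K : ℕ}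
    {L Δ σ b b' : ℝ} (h : AdmitsHardInstance.{u} W R K L Δ σ b) (hb : b' ≤ b) :
    AdmitsHardInstance.{u} W R K L Δ σ b' := by
  obtain ⟨d, x₀, f, O, hd, hf, hO, H⟩ := h
  exact ⟨d, x₀, f, O, hd, hf, hO, fun Ω _ μ _ ξ x xhat hrun =>
    (ENNReal.ofReal_le_ofReal hb).trans (H Ω μ ξ x xhat hrun)⟩

/-- Constant functions settle the cases L = 0 and Δ = 0, in which the claimed bound is 0. -/
theorem admitsHardInstance_zero.{u} {n : ℕ} (W : Matrix (Fin n) (Fin n) ℝ) (R K : ℕ)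
    {L Δ : ℝ} (hL : 0 ≤ L) (hΔ : 0 ≤ Δ) (σ : ℝ) : AdmitsHardInstance.{u} W R K L Δ σ 0 := by
  have hgrad : ∀ x : EuclideanSpace ℝ (Fin 1), gradient (fun _ => (0 : ℝ)) x = 0 := by
    intro x; simp [gradient]
  refine ⟨1, 0, fun _ _ => 0, exactOracle (fun _ _ => 0) (fun _ => measurable_const), one_pos,
    ⟨fun i => differentiable_const _, fun i x y => ?_, fun x => ?_⟩,
    exactOracle_inOracleClass _ (fun _ x => hgrad x) σ, ?_⟩
  · rw [hgrad, hgrad]; simp; positivity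
  · simp [avgFun, hΔ]
  · intros; simp

/-- The weights that give the even terms of the chain to the first `m` nodes and the odd ones to
the last `m` nodes. -/
noncomputable def splitWeight (n m T : ℕ) (i : Fin n) (k : ℕ) : ℝ :=
  if k < T ∧ ((Even k ∧ (i : ℕ) < m) ∨ (¬ Even k ∧ n - m ≤ i)) then n / m else 0

theorem sum_splitWeight {n m T k : ℕ} (hm : 0 < m) (hmn : m ≤ n) (hk : k < T) :
    ∑ i, splitWeight n m T i k = n := by
  have hm' : (m : ℝ) ≠ 0 := by positivity
  simp only [splitWeight, hk, true_and]
  rw [Fin.sum_univ_eq_sum_range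
    (fun i => if (Even k ∧ i < m) ∨ (¬ Even k ∧ n - m ≤ i) then (n : ℝ) / m else 0),
    ← Finset.sum_filter, Finset.sum_const, nsmul_eq_mul]
  have hcard : (Finset.filter (fun i => (Even k ∧ i < m) ∨ (¬ Even k ∧ n - m ≤ i))
      (Finset.range n)).card = m := by
    by_cases he : Even k
    · have : Finset.filter (fun i => (Even k ∧ i < m) ∨ (¬ Even k ∧ n - m ≤ i))
          (Finset.range n) = Finset.range m := by
        ext i; simp only [he, Finset.mem_filter, Finset.mem_range]; simp; omega
      rw [this, Finset.card_range]
    · have : Finset.filter (fun i => (Even k ∧ i < m) ∨ (¬ Even k ∧ n - m ≤ i))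
          (Finset.range n) = Finset.Ico (n - m) n := by
        ext i; simp only [he, Finset.mem_filter, Finset.mem_range, Finset.mem_Ico]; simp; omega
      rw [this, Nat.card_Ico]; omega
  rw [hcard]
  field_simp

/-- Two coordinates are granted per D rounds, and D is of order n; so the KR rounds leave at least
one coordinate of the chain undiscovered. -/
theorem admitsHardInstance_split.{u} {n : ℕ} (hn : 2 ≤ n) {W : Matrix (Fin n) (Fin n) ℝ}
    (hW : ∀ i j, W i j ≠ 0 → (i : ℕ) ≤ j + 1) (R : ℕ) {K : ℕ} (hK : n ≤ K) {L Δ : ℝ}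
    (hL : 0 < L) (hΔ : 0 < Δ) (σ : ℝ) :
    AdmitsHardInstance.{u} W R K L Δ σ (L * Δ * n / (6912 * (12 * R + 2) * K)) := by
  -- m = ⌈n/3⌉ keeps the weights n/m at most 3, and D is the climb from the index m - 1 to the index
  -- n - m. T is one more than the largest possible number of discovered coordinates.
  set m := (n + 2) / 3 with hm
  set D := n + 1 - 2 * m with hD
  set T := 2 * (K * R / D) + 2 with hT
  have hm0 : 0 < m := by omega
  have hD0 : 0 < D := by omega
  have hT0 : 0 < T := by omega
  have hw3 : ∀ i k, |splitWeight n m T i k| ≤ 3 := by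
    intro i k
    have hm' : (0 : ℝ) < m := by exact_mod_cast hm0
    have h3 : (n : ℝ) / m ≤ 3 := by
      rw [div_le_iff₀ hm']
      exact_mod_cast (by omega : n ≤ 3 * m)
    unfold splitWeight
    split_ifs
    · rwa [abs_of_nonneg (by positivity)]
    · simp
  have hwT : ∀ i, splitWeight n m T i T = 0 := fun i => by simp [splitWeight]
  have havg : ∀ k < T, ∑ i, splitWeight n m T i k = n :=
    fun k hk => sum_splitWeight hm0 (by omega) hk
  have hmeas : ∀ i, Measurable (scaledChainGrad (T := T) L Δ (splitWeight n m T i)) :=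
    fun i => (continuous_scaledChainGrad L Δ (hw3 i)).measurable
  refine ⟨T, 0, fun i => scaledChain L Δ (splitWeight n m T i),
    exactOracle (fun i => scaledChainGrad L Δ (splitWeight n m T i)) hmeas, hT0,
    scaledChain_inFunctionClass (by omega) hL hΔ hT0 hw3 hwT havg,
    exactOracle_inOracleClass hmeas (fun i x => gradient_scaledChain L Δ (hwT i) x) σ, ?_⟩
  intro Ω _ μ _ ξ x xhat hrun
  have hxhat : ∀ ω, xhat ω ∈ headSpace T (T - 1) := by
    intro ω
    refine hrun.output_mem_of_iterate_mem fun k hk i => ?_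
    have hmem := memory_le_headSpace_splitBound hW hD0 (a := m - 1) R K
      (g := fun l j => scaledChainGrad L Δ (splitWeight n m T j) (x l j ω)) (fun k hk i hle => ?_)
      k hk i (hrun.iterate_mem k i ω hk)
    · exact headSpace_mono (splitBound_le (m - 1) D (Nat.mul_le_mul_right R hk) i) hmem
    · have hx := hle (hrun.iterate_mem k i ω hk.le)
      refine scaledChainGrad_mem_headSpace_of_weight_eq_zero L Δ hx ?_
      rw [splitWeight, if_neg]
      have hmod := Nat.mod_lt (k * R) hD0
      have hi := i.2
      -- Owners of even terms are always within the front, where the next coordinate is odd. The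
      -- front is at most m - 1 + D - 1 = n - m - 1, so for owners of odd terms the next coordinate
      -- is even.
      rintro ⟨-, ⟨he, hlt⟩ | ⟨he, hge⟩⟩
      · rw [splitBound, if_pos (by omega)] at he
        exact Nat.not_even_two_mul_add_one _ he
      · rw [splitBound, if_neg (by omega), add_zero] at he
        exact he (even_two_mul _)
  have hbound : L * Δ * n / (6912 * (12 * R + 2) * K) ≤ L * Δ / (6912 * T) := by
    have hKn : (n : ℝ) ≤ K := by exact_mod_cast hK
    have hn0 : (0 : ℝ) < n := by exact_mod_cast (by omega : 0 < n)
    have hK0 : (0 : ℝ) < K := hn0.trans_le hKn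
    have hT' : (0 : ℝ) < T := by exact_mod_cast hT0
    have hTn : (T : ℝ) * n ≤ (12 * R + 2) * K := by
      have h1 : D * (K * R / D) ≤ K * R := Nat.mul_div_le _ _
      have h2 : n ≤ 6 * D := by omega
      have h3 : n * (K * R / D) ≤ 6 * (K * R) :=
        (Nat.mul_le_mul_right _ h2).trans (by rw [mul_assoc]; exact Nat.mul_le_mul_left 6 h1)
      have h4 : T * n ≤ (12 * R + 2) * K := by
        calc T * n = 2 * (n * (K * R / D)) + 2 * n := by rw [hT]; ring
          _ ≤ 2 * (6 * (K * R)) + 2 * K := by omega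
          _ = _ := by ring
      exact_mod_cast h4
    rw [div_le_div_iff₀ (by positivity) (by positivity)]
    calc L * Δ * n * (6912 * T) = L * Δ * 6912 * (T * n) := by ring
      _ ≤ L * Δ * 6912 * ((12 * R + 2) * K) := mul_le_mul_of_nonneg_left hTn (by positivity)
      _ = _ := by ring
  rw [avgFun_scaledChain (by omega) L Δ havg]
  calc ENNReal.ofReal (L * Δ * n / (6912 * (12 * R + 2) * K))
      = ∫⁻ _ : Ω, ENNReal.ofReal (L * Δ * n / (6912 * (12 * R + 2) * K)) ∂μ := by simp
    _ ≤ _ := lintegral_mono fun ω => ENNReal.ofReal_le_ofReal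
        (hbound.trans (le_norm_gradient_scaledChain_sq hL hΔ hT0 (hxhat ω)))

/-! ### Statistical lower bound -/

section Coin

/-- The law of a coin that shows `true` with probability `p`. -/
noncomputable def coinLaw (p : ℝ) : Measure Bool :=
  ENNReal.ofReal p • Measure.dirac true + ENNReal.ofReal (1 - p) • Measure.dirac false

theorem isProbabilityMeasure_coinLaw {p : ℝ} (h0 : 0 ≤ p) (h1 : p ≤ 1) :
    IsProbabilityMeasure (coinLaw p) := by
  refine ⟨?_⟩
  simp only [coinLaw, Measure.coe_add, Measure.coe_smul, Pi.add_apply, Pi.smul_apply,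
    measure_univ, smul_eq_mul, mul_one]
  rw [← ENNReal.ofReal_add h0 (by linarith)]
  simp

theorem coinLaw_true (p : ℝ) : coinLaw p {true} = ENNReal.ofReal p := by
  simp [coinLaw]

theorem integrable_coinLaw {E : Type*} [NormedAddCommGroup E] {p : ℝ} (h0 : 0 ≤ p) (h1 : p ≤ 1)
    (h : Bool → E) : Integrable h (coinLaw p) :=
  haveI := isProbabilityMeasure_coinLaw h0 h1
  Integrable.of_finite

theorem integral_coinLaw {E : Type*} [NormedAddCommGroup E] [NormedSpace ℝ E] [CompleteSpace E]
    {p : ℝ} (h0 : 0 ≤ p) (h1 : p ≤ 1) (h : Bool → E) :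
    ∫ s, h s ∂(coinLaw p) = p • h true + (1 - p) • h false := by
  have hi : ∀ b, Integrable h (Measure.dirac b) := fun b => Integrable.of_finite
  rw [coinLaw, integral_add_measure ((hi _).smul_measure ENNReal.ofReal_ne_top)
    ((hi _).smul_measure ENNReal.ofReal_ne_top), integral_smul_measure, integral_smul_measure,
    integral_dirac, integral_dirac, ENNReal.toReal_ofReal h0, ENNReal.toReal_ofReal (by linarith)]

end Coin

section Frontier

variable {T : ℕ}

open Classical in
/-- The part of `v` in the first undiscovered coordinate of `x`. -/
noncomputable def frontierPart (x v : EuclideanSpace ℝ (Fin T)) : EuclideanSpace ℝ (Fin T) :=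
  WithLp.toLp 2 fun i => if x ∈ headSpace T i ∧ prevCoord i x ≠ 0 then v i else 0

open Classical in
theorem frontierPart_apply (x v : EuclideanSpace ℝ (Fin T)) (i : Fin T) :
    frontierPart x v i = if x ∈ headSpace T i ∧ prevCoord i x ≠ 0 then v i else 0 := rfl

theorem measurable_prevCoord (k : ℕ) : Measurable (prevCoord (T := T) k) :=
  (continuous_iff_continuousAt.2 fun x => (hasFDerivAt_prevCoord k x).continuousAt).measurable

theorem measurable_frontierPart {G : EuclideanSpace ℝ (Fin T) → EuclideanSpace ℝ (Fin T)}
    (hG : Measurable G) : Measurable fun x => frontierPart x (G x) := by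
  classical
  refine (WithLp.measurable_toLp 2 (Fin T → ℝ)).comp (measurable_pi_lambda _ fun i => ?_)
  refine Measurable.ite ?_ ?_ measurable_const
  · exact ((headSpace T i).closed_of_finiteDimensional.measurableSet).inter
      ((measurable_prevCoord i) (measurableSet_singleton 0).compl)
  · exact (EuclideanSpace.proj (𝕜 := ℝ) i).continuous.measurable.comp hG

/-- At most one index lies beyond all nonzero coordinates and has a nonzero predecessor, so the
frontier part has at most one nonzero entry. -/
theorem norm_frontierPart_sq_le {x v : EuclideanSpace ℝ (Fin T)} {c : ℝ} (hc : 0 ≤ c)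
    (h : ∀ i : Fin T, x ∈ headSpace T i → v i ^ 2 ≤ c) : ‖frontierPart x v‖ ^ 2 ≤ c := by
  classical
  rw [EuclideanSpace.norm_sq_eq]
  simp only [Real.norm_eq_abs, sq_abs]
  by_cases hex : ∃ i : Fin T, x ∈ headSpace T i ∧ prevCoord i x ≠ 0
  · obtain ⟨i, hi, hpi⟩ := hex
    rw [Finset.sum_eq_single i]
    · rw [frontierPart_apply, if_pos ⟨hi, hpi⟩]; exact h i hi
    · intro j _ hji
      rw [frontierPart_apply, if_neg]
      · norm_num
      · rintro ⟨hj, hpj⟩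
        rcases lt_trichotomy (i : ℕ) j with hij | hij | hij
        · exact hpj (prevCoord_eq_zero hi hij)
        · exact hji (Fin.ext hij.symm)
        · exact hpi (prevCoord_eq_zero hj hij)
    · simp
  · push Not at hex
    refine (Finset.sum_nonpos fun i _ => ?_).trans hc
    rw [frontierPart_apply, if_neg]
    · norm_num
    · rintro ⟨h1, h2⟩; exact h2 (hex i h1)

theorem scaledChainGrad_apply (L Δ : ℝ) (w : ℕ → ℝ) (x : EuclideanSpace ℝ (Fin T)) (i : Fin T) :
    scaledChainGrad L Δ w x i = Δ / T * Real.sqrt (L * T / (27 * Δ)) *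
      chainPartial w i (Real.sqrt (L * T / (27 * Δ)) • x) := rfl

theorem prevCoord_smul_eq_zero {k : ℕ} (b : ℝ) {x : EuclideanSpace ℝ (Fin T)}
    (h : prevCoord k x = 0) : prevCoord k (b • x) = 0 := by
  cases k with
  | zero => simp [prevCoord] at h
  | succ k => simp only [prevCoord] at h ⊢; rw [coord_smul, h, mul_zero]

/-- An undiscovered coordinate with vanishing predecessor has partial derivative 0, so only the
frontier part can reveal anything. The frontier depends on `x` alone, as an oracle without memory
requires. -/
theorem scaledChainGrad_sub_frontierPart_mem (L Δ : ℝ) (w : ℕ → ℝ) {m : ℕ}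
    {x : EuclideanSpace ℝ (Fin T)} (hx : x ∈ headSpace T m) :
    scaledChainGrad L Δ w x - frontierPart x (scaledChainGrad L Δ w x) ∈ headSpace T m := by
  classical
  refine mem_headSpace_iff_fin.2 fun i hi => ?_
  rw [PiLp.sub_apply, frontierPart_apply]
  have hxi := headSpace_mono hi hx
  split_ifs with h
  · exact sub_self _
  · have h0 : prevCoord i x = 0 := by
      by_contra h1; exact h ⟨hxi, h1⟩
    rw [sub_zero, scaledChainGrad_apply,
      chainPartial_of_mem_headSpace w (Submodule.smul_mem _ _ hxi), prevCoord_smul_eq_zero _ h0]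
    simp

theorem frontierPart_scaledChainGrad_mem (L Δ : ℝ) (w : ℕ → ℝ) {m : ℕ}
    {x : EuclideanSpace ℝ (Fin T)} (hx : x ∈ headSpace T m) :
    frontierPart x (scaledChainGrad L Δ w x) ∈ headSpace T (m + 1) := by
  have h := Submodule.sub_mem _ (scaledChainGrad_mem_headSpace L Δ w hx)
    (headSpace_mono (Nat.le_succ m) (scaledChainGrad_sub_frontierPart_mem L Δ w hx))
  rwa [sub_sub_cancel] at h

theorem norm_frontierPart_scaledChainGrad_sq_le {L Δ : ℝ} (hL : 0 < L) (hΔ : 0 < Δ) (hT : 0 < T)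
    (x : EuclideanSpace ℝ (Fin T)) :
    ‖frontierPart x (scaledChainGrad L Δ (unitWeight T) x)‖ ^ 2 ≤ L * Δ / (27 * T) := by
  refine norm_frontierPart_sq_le (by positivity) fun i hi => ?_
  rw [scaledChainGrad_apply, mul_pow, scaledChainGrad_factor_sq hL hΔ hT,
    chainPartial_of_mem_headSpace _ (Submodule.smul_mem _ _ hi), unitWeight, if_pos i.2, one_mul,
    neg_sq]
  exact mul_le_of_le_one_right (by positivity)
    (pow_le_one₀ (tentStep_nonneg _) (tentStep_le_one _))

end Frontier

/-- The oracle that reveals the first undiscovered coordinate of the gradient with probability `p`,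
rescaled to be unbiased. -/
noncomputable def coinOracle (n : ℕ) {T : ℕ} {p : ℝ} (h0 : 0 ≤ p) (h1 : p ≤ 1)
    {G : EuclideanSpace ℝ (Fin T) → EuclideanSpace ℝ (Fin T)} (hG : Measurable G) :
    StochasticOracles n T where
  Ξ := Bool
  law := fun _ => coinLaw p
  isProbabilityMeasure := fun _ => isProbabilityMeasure_coinLaw h0 h1
  grad := fun _ x s => (G x - frontierPart x (G x)) +
    (if s = true then p⁻¹ else 0) • frontierPart x (G x)
  measurable_grad := fun _ => measurable_from_prod_countable_left fun s =>
    (hG.sub (measurable_frontierPart hG)).add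
      ((measurable_frontierPart hG).const_smul (if s = true then p⁻¹ else (0 : ℝ)))

/-- The error is 1/p - 1 or -1 times the frontier part, and p(1/p - 1)² + (1 - p) = (1 - p)/p. -/
theorem coinOracle_inOracleClass {n T : ℕ} {p σ : ℝ} (h0 : 0 < p) (h1 : p ≤ 1)
    {f : Fin n → EuclideanSpace ℝ (Fin T) → ℝ}
    {G : EuclideanSpace ℝ (Fin T) → EuclideanSpace ℝ (Fin T)} (hG : Measurable G)
    (hfG : ∀ i x, gradient (f i) x = G x)
    (hσ : ∀ x, (1 - p) / p * ‖frontierPart x (G x)‖ ^ 2 ≤ σ ^ 2) :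
    InOracleClass σ f (coinOracle n h0.le h1 hG) where
  integrable := fun i x => integrable_coinLaw h0.le h1 _
  unbiased := fun i x => by
    refine (integral_coinLaw h0.le h1 _).trans ?_
    rw [hfG]
    simp only [coinOracle, if_true, Bool.false_eq_true, if_false, zero_smul, add_zero, smul_add,
      smul_smul, mul_inv_cancel₀ h0.ne', one_smul]
    module
  integrable_sq := fun i x => integrable_coinLaw h0.le h1 _
  variance := fun i x => by
    refine (integral_coinLaw h0.le h1 _).trans_le (le_trans (le_of_eq ?_) (hσ x))
    rw [hfG]
    have e1 : (coinOracle n h0.le h1 hG).grad i x true - G x =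
        (p⁻¹ - 1) • frontierPart x (G x) := by
      simp only [coinOracle, if_true]; module
    have e2 : (coinOracle n h0.le h1 hG).grad i x false - G x =
        (-1 : ℝ) • frontierPart x (G x) := by
      simp only [coinOracle, Bool.false_eq_true, if_false]; module
    have e3 := congrArg (fun z => ‖z‖ ^ 2) e1
    have e4 := congrArg (fun z => ‖z‖ ^ 2) e2
    simp only [norm_smul, mul_pow, Real.norm_eq_abs, sq_abs] at e3 e4
    refine (congrArg₂ (fun a b => p • a + (1 - p) • b) e3 e4).trans ?_
    simp only [smul_eq_mul]
    field_simp
    ring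

/-- Gossip creates no new directions, so it cannot replace a successful coin. -/
theorem gossip_iterate_le {n d : ℕ} (W : Matrix (Fin n) (Fin n) ℝ)
    {V : Submodule ℝ (EuclideanSpace ℝ (Fin d))} (r : ℕ)
    {M : Fin n → Submodule ℝ (EuclideanSpace ℝ (Fin d))} (hM : ∀ i, M i ≤ V) (i : Fin n) :
    (gossip W)^[r] M i ≤ V := by
  induction r generalizing M with
  | zero => exact hM i
  | succ r ih =>
    rw [Function.iterate_succ_apply]
    exact ih fun i => sup_le (hM i) (iSup₂_le fun j _ => hM j)

/-- If every discovery of a coordinate needs a success `s l j`, the number of successes bounds the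
number of discovered coordinates. -/
theorem memory_le_headSpace_successes {n T : ℕ} (W : Matrix (Fin n) (Fin n) ℝ) (R K : ℕ)
    {g : ℕ → Fin n → EuclideanSpace ℝ (Fin T)} (s : ℕ → Fin n → Bool)
    (hfail : ∀ k < K, ∀ i m, s k i = false → memory W R 0 g k i ≤ headSpace T m →
      g k i ∈ headSpace T m)
    (hsucc : ∀ k < K, ∀ i m, memory W R 0 g k i ≤ headSpace T m → g k i ∈ headSpace T (m + 1)) :
    ∀ k ≤ K, ∀ i, memory W R 0 g k i ≤
      headSpace T (∑ l ∈ Finset.range k, ∑ j, if s l j = true then 1 else 0) := by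
  intro k
  induction k with
  | zero => intro _ i; simp [memory]
  | succ k ih =>
    intro hk i
    have hk' := ih (by omega)
    refine gossip_iterate_le W R (fun i => sup_le ((hk' i).trans (headSpace_mono ?_)) ?_) i
    · exact Finset.sum_le_sum_of_subset (Finset.range_subset_range.2 (Nat.le_succ k))
    · rw [Submodule.span_singleton_le_iff_mem, Finset.sum_range_succ]
      cases hs : s k i with
      | false => exact headSpace_mono (Nat.le_add_right _ _) (hfail k (by omega) i _ hs (hk' i))
      | true =>
        refine headSpace_mono (Nat.add_le_add_left ?_ _) (hsucc k (by omega) i _ (hk' i))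
        have h := Finset.single_le_sum (f := fun j => if s k j = true then 1 else 0)
          (fun j _ => Nat.zero_le _) (Finset.mem_univ i)
        simpa [hs] using h

theorem lintegral_successes {n : ℕ} {Ω : Type*} [MeasurableSpace Ω] {μ : Measure Ω} {p : ℝ}
    {ξ : ℕ → Fin n → Ω → Bool} (hξ : ∀ k i, Measurable (ξ k i))
    (hlaw : ∀ k i, μ.map (ξ k i) = coinLaw p) (K : ℕ) :
    ∫⁻ ω, ((∑ l ∈ Finset.range K, ∑ j, if ξ l j ω = true then 1 else 0 : ℕ) : ENNReal) ∂μ =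
      K * n * ENNReal.ofReal p := by
  have hset : ∀ l j, MeasurableSet {ω | ξ l j ω = true} :=
    fun l j => hξ l j (measurableSet_singleton true)
  have hm : ∀ l j, Measurable fun ω => (if ξ l j ω = true then 1 else 0 : ENNReal) :=
    fun l j => Measurable.ite (hset l j) measurable_const measurable_const
  have h1 : ∀ l j, ∫⁻ ω, (if ξ l j ω = true then 1 else 0 : ENNReal) ∂μ = ENNReal.ofReal p := by
    intro l j
    have h2 : (fun ω => (if ξ l j ω = true then 1 else 0 : ENNReal)) =
        Set.indicator {ω | ξ l j ω = true} 1 := by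
      ext ω; simp [Set.indicator]
    rw [h2, lintegral_indicator_one (hset l j), ← coinLaw_true p, ← hlaw l j,
      Measure.map_apply (hξ l j) (measurableSet_singleton true)]
    rfl
  push_cast
  rw [lintegral_finsetSum _ fun l _ => Finset.measurable_fun_sum _ fun j _ => hm l j]
  simp_rw [lintegral_finsetSum _ fun j _ => hm _ j, h1]
  simp [mul_assoc]

/-- With probability at least 1/2 there are fewer than T successes, and then the last coordinate is
unknown; the probability turns 6912 into 13824. -/
theorem admitsHardInstance_coin.{u} {n : ℕ} (hn : 0 < n) (W : Matrix (Fin n) (Fin n) ℝ) (R : ℕ)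
    {K T : ℕ} (hK : 0 < K) (hT : 0 < T) {L Δ σ : ℝ} (hL : 0 < L) (hΔ : 0 < Δ)
    (hσ : L * Δ * (n * K) ≤ (T * σ) ^ 2) :
    AdmitsHardInstance.{u} W R K L Δ σ (L * Δ / (13824 * T)) := by
  have hn' : (0 : ℝ) < n := by exact_mod_cast hn
  have hK' : (0 : ℝ) < K := by exact_mod_cast hK
  have hT' : (0 : ℝ) < T := by exact_mod_cast hT
  -- This makes the expected number of successes at most T/2; if the cap 1 is attained, the oracle
  -- is exact.
  set p : ℝ := min 1 (T / (2 * (n * K))) with hp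
  have hp0 : 0 < p := lt_min one_pos (by positivity)
  have hp1 : p ≤ 1 := min_le_left _ _
  have hpT : K * n * p ≤ T / 2 := by
    have h := mul_le_mul_of_nonneg_left (min_le_right 1 ((T : ℝ) / (2 * (n * K))))
      (by positivity : (0 : ℝ) ≤ K * n)
    refine h.trans (le_of_eq ?_)
    field_simp
  have hw3 : ∀ k, |unitWeight T k| ≤ 3 := by
    intro k; unfold unitWeight; split_ifs <;> norm_num
  have havg : ∀ k < T, ∑ _i : Fin n, unitWeight T k = n := by
    intro k hk; simp [unitWeight, hk]
  have hG := (continuous_scaledChainGrad (T := T) L Δ hw3).measurable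
  refine ⟨T, 0, fun _ => scaledChain L Δ (unitWeight T), coinOracle n hp0.le hp1 hG, hT,
    scaledChain_inFunctionClass hn hL hΔ hT (fun _ => hw3) (fun _ => unitWeight_self) havg,
    coinOracle_inOracleClass hp0 hp1 hG
      (fun _ x => gradient_scaledChain L Δ unitWeight_self x) (fun x => ?_), ?_⟩
  · have h1 := norm_frontierPart_scaledChainGrad_sq_le hL hΔ hT x
    have h2 : (1 - p) / p ≤ 2 * (n * K) / T := by
      rcases min_choice 1 ((T : ℝ) / (2 * (n * K))) with h | h
      · rw [hp, h, sub_self, zero_div]; positivity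
      · have h3 : 2 * (n * K) / T * p = 1 := by
          rw [hp, h]
          field_simp
        rw [div_le_iff₀ hp0, h3]
        linarith
    calc _ ≤ 2 * (n * K) / T * (L * Δ / (27 * T)) :=
          mul_le_mul h2 h1 (sq_nonneg _) (by positivity)
      _ = 2 / 27 * (L * Δ * (n * K)) / T ^ 2 := by field_simp
      _ ≤ (T * σ) ^ 2 / T ^ 2 := by
          gcongr
          have : 0 ≤ L * Δ * (n * K) := by positivity
          linarith
      _ = σ ^ 2 := by field_simp
  intro Ω _ μ _ ξ x xhat hrun
  let ζ : ℕ → Fin n → Ω → Bool := ξ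
  have hζ : ∀ k i, Measurable (ζ k i) := hrun.measurable_sample
  let S : Ω → ℕ := fun ω => ∑ l ∈ Finset.range K, ∑ j, if ζ l j ω = true then 1 else 0
  have hxhat : ∀ ω, S ω < T → xhat ω ∈ headSpace T (T - 1) := by
    intro ω hS
    refine hrun.output_mem_of_iterate_mem fun k hk i => ?_
    have hmem := memory_le_headSpace_successes W R K (fun l j => ζ l j ω)
      (fun k hk i m hs hle => ?_) (fun k hk i m hle => ?_) k hk i (hrun.iterate_mem k i ω hk)
    · refine headSpace_mono (le_trans ?_ (Nat.le_sub_one_of_lt hS)) hmem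
      exact Finset.sum_le_sum_of_subset (Finset.range_subset_range.2 hk)
    · have hx := hle (hrun.iterate_mem k i ω hk.le)
      change _ + (if ζ k i ω = true then p⁻¹ else 0) • _ ∈ headSpace T m
      simp only [hs, Bool.false_eq_true, if_false, zero_smul, add_zero]
      exact scaledChainGrad_sub_frontierPart_mem L Δ _ hx
    · have hx := hle (hrun.iterate_mem k i ω hk.le)
      exact Submodule.add_mem _ (headSpace_mono (Nat.le_succ m)
        (scaledChainGrad_sub_frontierPart_mem L Δ _ hx))
        (Submodule.smul_mem _ _ (frontierPart_scaledChainGrad_mem L Δ _ hx))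
  have hmeasS : Measurable S := by
    refine Finset.measurable_fun_sum _ fun l _ => Finset.measurable_fun_sum _ fun j _ => ?_
    exact Measurable.ite (hζ l j (measurableSet_singleton true))
      measurable_const measurable_const
  have hbad : μ {ω | T ≤ S ω} ≤ 1 / 2 := by
    have h1 := mul_meas_ge_le_lintegral (μ := μ)
      (measurable_from_top.comp hmeasS : Measurable fun ω => (S ω : ENNReal)) (T : ENNReal)
    have h2 : ∫⁻ ω, (S ω : ENNReal) ∂μ = K * n * ENNReal.ofReal p :=
      lintegral_successes hζ hrun.map_sample K
    have h3 : (K * n * ENNReal.ofReal p : ENNReal) ≤ T * (1 / 2) := by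
      have := ENNReal.ofReal_le_ofReal hpT
      rw [ENNReal.ofReal_mul (by positivity), ENNReal.ofReal_mul (by positivity),
        ENNReal.ofReal_div_of_pos two_pos] at this
      simpa [div_eq_mul_inv] using this
    have h4 := (h1.trans_eq h2).trans h3
    have h5 : {ω | (T : ENNReal) ≤ S ω} = {ω | T ≤ S ω} := by ext ω; simp
    change (T : ENNReal) * μ {ω | (T : ENNReal) ≤ S ω} ≤ _ at h4
    rw [h5] at h4
    exact (ENNReal.mul_le_mul_iff_right (by exact_mod_cast hT.ne') (ENNReal.natCast_ne_top T)).1 h4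
  have hgood : 1 / 2 ≤ μ {ω | S ω < T} := by
    have h1 : {ω | S ω < T} = {ω | T ≤ S ω}ᶜ := by ext ω; simp
    rw [h1, prob_compl_eq_one_sub (show MeasurableSet {ω | T ≤ S ω} from hmeasS measurableSet_Ici)]
    refine ENNReal.le_sub_of_add_le_left (ne_top_of_le_ne_top (by simp) hbad) ?_
    refine (add_le_add hbad le_rfl).trans (le_of_eq (ENNReal.add_halves 1))
  rw [avgFun_scaledChain hn L Δ havg]
  calc ENNReal.ofReal (L * Δ / (13824 * T))
      = ENNReal.ofReal (L * Δ / (6912 * T)) * (1 / 2) := by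
        rw [show L * Δ / (13824 * T) = L * Δ / (6912 * T) / 2 by field_simp; norm_num,
          ENNReal.ofReal_div_of_pos two_pos]
        simp [div_eq_mul_inv]
    _ ≤ ENNReal.ofReal (L * Δ / (6912 * T)) * μ {ω | S ω < T} := by gcongr
    _ = ∫⁻ _ in {ω | S ω < T}, ENNReal.ofReal (L * Δ / (6912 * T)) ∂μ := by
        rw [setLIntegral_const]
    _ ≤ ∫⁻ ω in {ω | S ω < T}, ENNReal.ofReal
          (‖gradient (scaledChain L Δ (unitWeight T)) (xhat ω)‖ ^ 2) ∂μ :=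
        setLIntegral_mono' (hmeasS measurableSet_Iio) fun ω hω =>
          ENNReal.ofReal_le_ofReal (le_norm_gradient_scaledChain_sq hL hΔ hT (hxhat ω hω))
    _ ≤ _ := setLIntegral_le_lintegral _ _

/-! ### Choice of parameters and conclusion -/

/-- A mixing matrix with prescribed `β_π`, whose equilibrium skewness satisfies
`ln κ_π ≍ n (1 - β_π)`, and which moves mass upwards by at most one index. -/
theorem exists_mixingMatrix {n : ℕ} (hn : 2 ≤ n) {β : ℝ} (hβ : 0 < β) (hβ1 : β < 1) :
    ∃ (W : Matrix (Fin n) (Fin n) ℝ) (π : Fin n → ℝ),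
      IsMixingMatrix W ∧ IsEquilibriumVector W π ∧ betaPi W π = β ∧
      (∀ i j, W i j ≠ 0 → (i : ℕ) ≤ j + 1) ∧
      n * (1 - β) / 2 ≤ Real.log (kappaPi π) ∧
      Real.log (kappaPi π) ≤ 2 / β * (n * (1 - β)) := by
  have hlo : 1 - β ≤ Real.log β⁻¹ := by
    have := Real.one_sub_inv_le_log_of_pos (inv_pos.2 hβ)
    rwa [inv_inv] at this
  have hhi : Real.log β⁻¹ ≤ (1 - β) / β := by
    refine (Real.log_le_sub_one_of_pos (inv_pos.2 hβ)).trans (le_of_eq ?_)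
    field_simp
  have hnn : 0 ≤ (1 - β) / β := div_nonneg (by linarith) hβ.le
  obtain ⟨N, rfl⟩ : ∃ N, n = N + 1 := ⟨n - 1, by omega⟩
  have hN : (1 : ℝ) ≤ N := by exact_mod_cast (by omega : 1 ≤ N)
  have hrhs : 2 / β * (((N + 1 : ℕ) : ℝ) * (1 - β)) = 2 * (N + 1) * ((1 - β) / β) := by
    push_cast; field_simp
  rw [hrhs]
  push_cast
  -- Two nodes contract by r and three or more by √r, so the ratio is β or β² accordingly.
  rcases Nat.lt_or_ge N 2 with h | h
  · obtain rfl : N = 1 := by omega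
    refine ⟨resetMatrix 1 β, geomVector 1 β, resetMatrix_isMixingMatrix hβ hβ1,
      geomVector_isEquilibriumVector hβ, betaPi_resetMatrix_one hβ,
      fun i j => resetMatrix_ne_zero_le, ?_, ?_⟩ <;>
    · rw [log_kappaPi_geomVector hβ hβ1]
      push_cast
      linarith
  · have hr : 0 < β ^ 2 := by positivity
    have hr1 : β ^ 2 < 1 := pow_lt_one₀ hβ.le hβ1 two_ne_zero
    refine ⟨resetMatrix N (β ^ 2), geomVector N (β ^ 2), resetMatrix_isMixingMatrix hr hr1,
      geomVector_isEquilibriumVector hr, ?_, fun i j => resetMatrix_ne_zero_le, ?_, ?_⟩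
    · rw [betaPi_resetMatrix hr hr1 h, Real.sqrt_sq hβ.le]
    all_goals
      rw [log_kappaPi_geomVector hr hr1, ← inv_pow, Real.log_pow]
      push_cast
      nlinarith

/-- The statistical lower bound, with the optimal length of the chain. -/
theorem admitsHardInstance_statistical.{u} {n : ℕ} (hn : 0 < n) (W : Matrix (Fin n) (Fin n) ℝ)
    (R : ℕ) {K : ℕ} (hK : 0 < K) {L Δ σ : ℝ} (hL : 0 < L) (hΔ : 0 < Δ) (hσ : 0 < σ) :
    AdmitsHardInstance.{u} W R K L Δ σ
      (min (σ * Real.sqrt (L * Δ) / Real.sqrt ((n : ℝ) * (K : ℝ))) (L * Δ) / 27648) := by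
  have hn' : (0 : ℝ) < n := by exact_mod_cast hn
  have hK' : (0 : ℝ) < K := by exact_mod_cast hK
  have hu : 0 < Real.sqrt (L * Δ) := Real.sqrt_pos.2 (by positivity)
  have hv : 0 < Real.sqrt ((n : ℝ) * K) := Real.sqrt_pos.2 (by positivity)
  have hu2 : Real.sqrt (L * Δ) ^ 2 = L * Δ := Real.sq_sqrt (by positivity)
  have hv2 : Real.sqrt ((n : ℝ) * K) ^ 2 = n * K := Real.sq_sqrt (by positivity)
  set u := Real.sqrt (L * Δ)
  set v := Real.sqrt ((n : ℝ) * K)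
  -- The shortest chain that the variance constraint Tσ ≥ √(LΔnK) allows.
  set T := ⌈u * v / σ⌉₊ with hTdef
  have hT : 0 < T := Nat.ceil_pos.2 (by positivity)
  have hT' : (0 : ℝ) < T := by exact_mod_cast hT
  have hlow : u * v / σ ≤ T := Nat.le_ceil _
  have hupp : (T : ℝ) < u * v / σ + 1 := Nat.ceil_lt_add_one (by positivity)
  refine (admitsHardInstance_coin hn W R hK hT hL hΔ (σ := σ) ?_).mono ?_
  · rw [← hu2, ← hv2, ← mul_pow]
    refine pow_le_pow_left₀ (by positivity) ?_ 2
    rwa [div_le_iff₀ hσ] at hlow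
  · set q := min (σ * u / v) (L * Δ) with hq
    have hq0 : 0 ≤ q := le_min (by positivity) (by positivity)
    -- The unrounded length times q is at most LΔ, and rounding adds at most q, which the minimum
    -- caps by LΔ.
    have h1 : T * q ≤ 2 * (L * Δ) := by
      have h2 : u * v / σ * q ≤ L * Δ := by
        calc u * v / σ * q ≤ u * v / σ * (σ * u / v) :=
              mul_le_mul_of_nonneg_left (min_le_left _ _) (by positivity)
          _ = u ^ 2 := by field_simp
          _ = L * Δ := hu2
      have h3 : q ≤ L * Δ := min_le_right _ _
      calc T * q ≤ (u * v / σ + 1) * q := mul_le_mul_of_nonneg_right hupp.le hq0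
        _ ≤ _ := by linarith
    rw [div_le_div_iff₀ (by norm_num) (by positivity)]
    linarith

theorem theorem1 (β₀ : ℝ) (hβ₀ : 0 < β₀) (R : ℕ) :
    ∃ c : ℝ, 0 < c ∧ ∀ (n : ℕ), 2 ≤ n → ∀ β : ℝ, β₀ ≤ β → β ≤ 1 - 1 / (n : ℝ) →
      ∃ (W : Matrix (Fin n) (Fin n) ℝ) (π : Fin n → ℝ),
        IsMixingMatrix W ∧ IsEquilibriumVector W π ∧ betaPi W π = β ∧
        c * ((n : ℝ) * (1 - betaPi W π)) ≤ Real.log (kappaPi π) ∧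
        ∀ (L Δ σ : ℝ), 0 ≤ L → 0 ≤ Δ → 0 ≤ σ → ∀ K : ℕ, n ≤ K →
          ∃ (d : ℕ) (x₀ : EuclideanSpace ℝ (Fin d))
            (f : Fin n → EuclideanSpace ℝ (Fin d) → ℝ) (O : StochasticOracles n d),
            0 < d ∧ InFunctionClass L Δ x₀ f ∧ InOracleClass σ f O ∧
            ∀ (Ω : Type*) [MeasurableSpace Ω] (μ : Measure Ω) [IsProbabilityMeasure μ]
              (ξ : ℕ → Fin n → Ω → O.Ξ) (x : ℕ → Fin n → Ω → EuclideanSpace ℝ (Fin d))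
              (xhat : Ω → EuclideanSpace ℝ (Fin d)),
              IsLinearSpanningRun W R K x₀ O μ ξ x xhat →
              ENNReal.ofReal (c *
                (min (σ * Real.sqrt (L * Δ) / Real.sqrt ((n : ℝ) * (K : ℝ))) (L * Δ) +
                  (1 + Real.log (kappaPi π)) * L * Δ / ((1 - betaPi W π) * (K : ℝ)))) ≤
              ∫⁻ ω, ENNReal.ofReal (‖gradient (avgFun f) (xhat ω)‖ ^ 2) ∂μ := by
  -- A is the factor lost in the network bound, and C bounds (1 + ln κ_π)/(n(1 - β)).
  set A : ℝ := 12 * R + 2 with hA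
  set C : ℝ := 1 + 2 / β₀ with hC
  have hA2 : 2 ≤ A := by rw [hA]; linarith [Nat.cast_nonneg (α := ℝ) R]
  have hC1 : 1 ≤ C := by rw [hC]; linarith [div_pos two_pos hβ₀]
  have hAC : 2 ≤ A * C := by nlinarith
  have hc4 : 1 / (60000 * (A * C)) ≤ 1 / 2 :=
    one_div_le_one_div_of_le two_pos (by linarith)
  refine ⟨1 / (60000 * (A * C)), by positivity, fun n hn β hβ hβ1 => ?_⟩
  have hβ0 : 0 < β := hβ₀.trans_le hβ
  have hn' : (0 : ℝ) < n := by exact_mod_cast (by omega : 0 < n)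
  -- The upper limit on β enters here: it lets the 1 in 1 + ln κ_π be absorbed into n(1 - β).
  have hg : 1 ≤ n * (1 - β) := by
    have h : 1 / (n : ℝ) ≤ 1 - β := by linarith
    rwa [div_le_iff₀' hn'] at h
  have hβlt : 0 < 1 - β := pos_of_mul_pos_right (one_pos.trans_le hg) hn'.le
  obtain ⟨W, π, hmix, heq, hbeta, hband, hlo, hhi⟩ := exists_mixingMatrix hn hβ0 (by linarith)
  refine ⟨W, π, hmix, heq, hbeta, ?_, fun L Δ σ hL hΔ hσ K hK => ?_⟩
  · rw [hbeta]
    have := mul_le_mul_of_nonneg_right hc4 (zero_le_one.trans hg)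
    linarith
  change AdmitsHardInstance W R K L Δ σ _
  rw [hbeta]
  rcases hL.eq_or_lt with rfl | hL
  · exact (admitsHardInstance_zero W R K le_rfl hΔ σ).mono (by simp)
  rcases hΔ.eq_or_lt with rfl | hΔ
  · exact (admitsHardInstance_zero W R K hL.le le_rfl σ).mono (by simp)
  have hK0 : 0 < K := by omega
  have hK' : (0 : ℝ) < K := by exact_mod_cast hK0
  have hκ : 1 + Real.log (kappaPi π) ≤ C * (n * (1 - β)) := by
    have h1 : 2 / β ≤ 2 / β₀ := div_le_div_of_nonneg_left two_pos.le hβ₀ hβ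
    have h2 := mul_le_mul_of_nonneg_right h1 (zero_le_one.trans hg)
    rw [hC]
    linarith
  have hκ0 : 0 ≤ 1 + Real.log (kappaPi π) := by linarith
  set S := (1 + Real.log (kappaPi π)) * L * Δ / ((1 - β) * (K : ℝ)) with hS
  set q := min (σ * Real.sqrt (L * Δ) / Real.sqrt ((n : ℝ) * (K : ℝ))) (L * Δ) with hq
  have hS0 : 0 ≤ S := by positivity
  have hSle : S ≤ C * (L * Δ * n / K) := by
    rw [hS, div_le_iff₀ (by positivity)]
    calc (1 + Real.log (kappaPi π)) * L * Δ
        ≤ C * (n * (1 - β)) * L * Δ := by gcongr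
      _ = _ := by field_simp
  -- The larger of the two terms decides the instance. If σ = 0, then q = 0 and the first case
  -- applies.
  rcases le_or_gt q S with h | h
  · refine (admitsHardInstance_split hn hband R hK hL hΔ σ).mono ?_
    calc 1 / (60000 * (A * C)) * (q + S) ≤ 1 / (60000 * (A * C)) * (2 * (C * (L * Δ * n / K))) :=
          mul_le_mul_of_nonneg_left (by linarith) (by positivity)
      _ = L * Δ * n / (30000 * A * K) := by field_simp; norm_num
      _ ≤ L * Δ * n / (6912 * A * K) := by gcongr; norm_num
  · have hσ0 : 0 < σ := by
      rcases hσ.eq_or_lt with rfl | h1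
      · have : q ≤ 0 := (min_le_left _ _).trans (by simp)
        linarith
      · exact h1
    refine (admitsHardInstance_statistical (by omega) W R hK0 hL hΔ hσ0).mono ?_
    have hq0 : 0 ≤ q := hS0.trans h.le
    calc 1 / (60000 * (A * C)) * (q + S) ≤ 1 / (60000 * 2) * (2 * q) := by
          refine mul_le_mul ?_ (by linarith) (by linarith) (by positivity)
          exact one_div_le_one_div_of_le (by norm_num) (by linarith)
      _ ≤ q / 27648 := by linarith
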